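/- Let $n\ge 3$, $k>0$, and let $$\mathbb H^n_{-k^2}=\Big\{(x,t)\in\mathbb R^n\times\mathbb R:\ |x|^2-t^2=-\tfrac1{k^2},\ t>0\Big\}$$ be the hyperboloid model of hyperbolic space in Minkowski space $\mathbb R^{n,1}$ (form $\langle\cdot,\cdot\rangle=\sum_i dx_i^2-dt^2$), with base point $o=(0,1/k)$ and polar coordinates $$(x,t)=\tfrac1k\big(\sinh(kr)\,Y,\ \cosh(kr)\big),\qquad r\ge 0,\quad Y=(\phi_1,\dots,\phi_n)\in\mathbb S^{n-1},$$ so that $r$ is the geodesic distance from $o$; let $B_0(R)=\{r<R\}$. Let $\Sigma$ be a smooth $(n-1)$-manifold homeomorphic to $\mathbb S^{n-1}$ and let $F:\Sigma\to\mathbb H^n_{-k^2}$ be a smooth embedding whose induced Riemannian metric has all sectional curvatures $>-k^2$. Let $F(\Sigma)=\Sigma_0$ enclose the region $\Omega_0$, i.e. $\Omega_0$ is a bounded connected open subset of $\mathbb H^n_{-k^2}$ with boundary $\Sigma_0$, and let $N$ be the outward unit normal of $\Sigma_0$ in $\mathbb H^n_{-k^2}$. Suppose $R_1>0$ and $B_0(R_1)\subset\Omega_0\subset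 B_0(R_2)$. For $p\in\Sigma$ and $\rho\in\mathbb R$ put $$X(p,\rho)=\cosh(k\rho)\,F(p)+\tfrac1k\sinh(k\rho)\,N(p),$$ the point at parameter $\rho$ on the unit-speed geodesic starting from $F(p)$ with velocity $N(p)$. Let $y\in\mathbb R^n$ with $\sum_i y_i^2=1$, and regard $r$ and $\phi=\sum_{i=1}^n\phi_i y_i$ as functions of $(p,\rho)$ through $X(p,\rho)$. Then for all $p\in\Sigma$ and $\rho>0$: $r>0$ at $(p,\rho)$ (so $\phi$ is defined there), $r$ and $\phi$ are differentiable in $\rho$, and 1. $\displaystyle\Big(\frac{\partial\phi}{\partial\rho}\Big)^2\le(1-\phi^2)\,k^2\sinh^{-2}(kr)\Big(1-\Big(\frac{\partial r}{\partial\rho}\Big)^2\Big)$; 2. $\displaystyle\frac{\partial r}{\partial\rho}\ge\frac{\sinh kR_1}{\sinh kR_2}$; 3. $\displaystyle\Big|\frac{\partial\phi}{\partial\rho}\Big|\le\mu k\,\frac{\partial r}{\partial\rho}$, where $\displaystyle\mu=\frac1{\sinh kR_1}\Big(\frac{\sinh^2kR_2}{\sinh^2kR_1}-1\Big)^{1/2}$.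 -/

import Mathlib

open Set Filter Topology
open scoped Manifold ContDiff

noncomputable section

namespace HypFoliation

/-- The vector space `ℝⁿ × ℝ` underlying Minkowski space `ℝ^{n,1}`; a point is `(x, t)`. -/
abbrev Mink (n : ℕ) : Type := EuclideanSpace ℝ (Fin n) × ℝ

/-- The Lorentz form `∑ xᵢ yᵢ - t s` of `ℝ^{n,1}`. -/
def lorentz {n : ℕ} (v w : Mink n) : ℝ := inner ℝ v.1 w.1 - v.2 * w.2

/-- The hyperboloid model of the hyperbolic space of constant sectional curvature `-k²`. -/
def Hyp (n : ℕ) (k : ℝ) : Set (Mink n) :=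
  {X | lorentz X X = -(1 / k ^ 2) ∧ 0 < X.2}

/-- The geodesic distance `r` from the base point `o = (0, 1/k)`: the number `r ≥ 0` with
`t = cosh (k r) / k`. -/
def radius {n : ℕ} (k : ℝ) (X : Mink n) : ℝ := Real.arcosh (k * X.2) / k

/-- The spherical coordinate `Y = (φ₁, …, φₙ)`, a point of the unit sphere of `ℝⁿ`
whenever `X ≠ o`. -/
def angular {n : ℕ} (X : Mink n) : EuclideanSpace ℝ (Fin n) := ‖X.1‖⁻¹ • X.1

/-- Polar coordinates: `X = (1/k) (sinh (k r) Y, cosh (k r))` on the hyperboloid. -/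
theorem polar {n : ℕ} {k : ℝ} (hk : 0 < k) {X : Mink n} (hX : X ∈ Hyp n k) :
    X = (1 / k) • (Real.sinh (k * radius k X) • angular X, Real.cosh (k * radius k X)) := by
  obtain ⟨h1, h2⟩ := hX
  rw [lorentz, real_inner_self_eq_norm_sq] at h1
  have hkt : (k * X.2) ^ 2 = 1 + (k * ‖X.1‖) ^ 2 := by
    have : X.2 ^ 2 = ‖X.1‖ ^ 2 + 1 / k ^ 2 := by linarith
    rw [mul_pow, this]
    field_simp
    ring
  have h1t : 1 ≤ k * X.2 := by
    have : 0 < k * X.2 := mul_pos hk h2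
    nlinarith [sq_nonneg (k * ‖X.1‖)]
  have hr : k * radius k X = Real.arcosh (k * X.2) := by
    rw [radius]; field_simp
  have hs : Real.sinh (Real.arcosh (k * X.2)) = k * ‖X.1‖ := by
    have h0 : 0 ≤ Real.sinh (Real.arcosh (k * X.2)) :=
      Real.sinh_nonneg_iff.2 (Real.arcosh_nonneg h1t)
    have := Real.cosh_sq (Real.arcosh (k * X.2))
    rw [Real.cosh_arcosh h1t] at this
    exact (sq_eq_sq₀ h0 (by positivity)).1 (by linarith)
  rw [hr, hs, Real.cosh_arcosh h1t, angular]
  ext1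
  · rcases eq_or_ne X.1 0 with h | h
    · simp [h]
    · have : ‖X.1‖ ≠ 0 := norm_ne_zero_iff.2 h
      simp only [Prod.smul_mk, smul_smul]
      rw [show 1 / k * (k * ‖X.1‖ * ‖X.1‖⁻¹) = 1 by field_simp, one_smul]
  · simp only [Prod.smul_mk, smul_eq_mul]
    field_simp

/-- The open geodesic ball `B₀(R)` with centre `o` in the hyperbolic space. -/
def geodBall (n : ℕ) (k R : ℝ) : Set (Hyp n k) := {X | radius k (X : Mink n) < R}

/-! ### Riemannian curvature in coordinates -/

/-- The partial derivative `∂ᵢ f` on `ℝᵈ`. -/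
def pd {d : ℕ} {E : Type*} [NormedAddCommGroup E] [NormedSpace ℝ E] (i : Fin d)
    (f : EuclideanSpace ℝ (Fin d) → E) (x : EuclideanSpace ℝ (Fin d)) : E :=
  fderiv ℝ f x (EuclideanSpace.single i 1)

/-- The Christoffel symbol `Γˡᵢⱼ` of the metric with coefficient matrix `g`. -/
def christoffel {d : ℕ} (g : EuclideanSpace ℝ (Fin d) → Matrix (Fin d) (Fin d) ℝ)
    (l i j : Fin d) (x : EuclideanSpace ℝ (Fin d)) : ℝ :=
  (1 / 2) * ∑ m, (g x)⁻¹ l m *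
    (pd i (fun z => g z j m) x + pd j (fun z => g z i m) x - pd m (fun z => g z i j) x)

/-- The component `Rˡᵢⱼₖ` of the curvature tensor, `R(∂ᵢ, ∂ⱼ) ∂ₖ = ∑ₗ Rˡᵢⱼₖ ∂ₗ`, where
`R(U, V) W = ∇_U ∇_V W - ∇_V ∇_U W - ∇_[U,V] W`. -/
def riemann {d : ℕ} (g : EuclideanSpace ℝ (Fin d) → Matrix (Fin d) (Fin d) ℝ)
    (l i j k : Fin d) (x : EuclideanSpace ℝ (Fin d)) : ℝ :=
  pd i (christoffel g l j k) x - pd j (christoffel g l i k) x +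
    ∑ m, (christoffel g m j k x * christoffel g l i m x -
      christoffel g m i k x * christoffel g l j m x)

/-- The sectional curvature `⟨R(v, w) w, v⟩ / (|v|² |w|² - ⟨v, w⟩²)` at `x` of the plane spanned
by the (linearly independent) coordinate vectors `v` and `w`. -/
def sectional {d : ℕ} (g : EuclideanSpace ℝ (Fin d) → Matrix (Fin d) (Fin d) ℝ)
    (x : EuclideanSpace ℝ (Fin d)) (v w : Fin d → ℝ) : ℝ :=
  (∑ i, ∑ j, ∑ k, ∑ l, ∑ m, v i * w j * w k * v m * (g x l m * riemann g l i j k x)) /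
    ((∑ i, ∑ j, g x i j * v i * v j) * (∑ i, ∑ j, g x i j * w i * w j) -
      (∑ i, ∑ j, g x i j * v i * w j) ^ 2)

/-! ### Hypersurfaces of the hyperbolic space -/

section Hypersurface

variable {n : ℕ} {k : ℝ} {S : Type*} [TopologicalSpace S]
  [ChartedSpace (EuclideanSpace ℝ (Fin (n - 1))) S]

/-- `F` as a map into the vector space `ℝ^{n,1}`. -/
def position (F : S → Hyp n k) : S → Mink n := fun p => (F p : Mink n)

/-- `F` is a smooth embedding (an injective immersion; the source will be compact). -/
def IsSmoothEmb (F : S → Hyp n k) : Prop :=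
  ContMDiff (𝓡 (n - 1)) 𝓘(ℝ, Mink n) ∞ (position F) ∧ Function.Injective F ∧
    ∀ p, Function.Injective (mfderiv (𝓡 (n - 1)) 𝓘(ℝ, Mink n) (position F) p)

/-- The coefficients `gᵢⱼ = ⟨∂ᵢ F, ∂ⱼ F⟩` of the metric induced by `F`, in the preferred chart
around the point `p`. -/
def inducedMetric (F : S → Hyp n k) (p : S) (x : EuclideanSpace ℝ (Fin (n - 1))) :
    Matrix (Fin (n - 1)) (Fin (n - 1)) ℝ :=
  Matrix.of fun i j =>
    lorentz (pd i (position F ∘ (extChartAt (𝓡 (n - 1)) p).symm) x)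
      (pd j (position F ∘ (extChartAt (𝓡 (n - 1)) p).symm) x)

/-- Every sectional curvature of the metric induced by `F` is greater than `c`. -/
def SectionalCurvatureGT (F : S → Hyp n k) (c : ℝ) : Prop :=
  ∀ (p : S) (v w : Fin (n - 1) → ℝ), LinearIndependent ℝ ![v, w] →
    c < sectional (inducedMetric F p) (extChartAt (𝓡 (n - 1)) p p) v w

/-- The hypersurface `F(S)` encloses the region `Ω₀`: `Ω₀` is a bounded connected open set of the
hyperbolic space whose boundary there is `F(S)`. -/
def Encloses (F : S → Hyp n k) (Ω₀ : Set (Hyp n k)) : Prop :=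
  IsOpen Ω₀ ∧ IsConnected Ω₀ ∧ (∃ R, Ω₀ ⊆ geodBall n k R) ∧ frontier Ω₀ = range F

/-- The point `X(p, ρ)` at parameter `ρ` of the unit speed geodesic issuing from `F(p)` with
initial velocity `N(p)`. -/
def flow (F : S → Hyp n k) (N : S → Mink n) (p : S) (ρ : ℝ) : Mink n :=
  Real.cosh (k * ρ) • (F p : Mink n) + ((1 / k) * Real.sinh (k * ρ)) • N p

/-- `N` is the unit normal of the hypersurface in the hyperbolic space which points out of the
closed region bounded by the hypersurface. -/
def IsOutwardUnitNormal (F : S → Hyp n k) (Ω₀ : Set (Hyp n k)) (N : S → Mink n) : Prop :=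
  ∀ p, lorentz (N p) (N p) = 1 ∧ lorentz (N p) (F p : Mink n) = 0 ∧
    (∀ v : TangentSpace (𝓡 (n - 1)) p,
      lorentz (N p) (mfderiv (𝓡 (n - 1)) 𝓘(ℝ, Mink n) (position F) p v : Mink n) = 0) ∧
    ∀ᶠ s in 𝓝[>] (0 : ℝ), flow F N p s ∉ (Subtype.val '' closure Ω₀ : Set (Mink n))

end Hypersurface

end HypFoliation

end

namespace HypFoliation

/-! ### Local strict convexity of the boundary implies convexity -/

section Euclidean

variable {E : Type*} [NormedAddCommGroup E] [InnerProductSpace ℝ E]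

/-- The part of the ball `B(G p, δ)` on the positive side of the tangent hyperplane at `G q`. -/
def outerCap {S : Type*} (G a : S → E) (p : S) (δ : ℝ) (q : S) : Set E :=
  Metric.ball (G p) δ ∩ {u | 0 < inner ℝ (a q) (u - G q)}

theorem isPreconnected_outerCap {S : Type*} {G a : S → E} (p q : S) (δ : ℝ) :
    IsPreconnected (outerCap G a p δ q) := by
  refine ((convex_ball _ _).inter ?_).isPreconnected
  have : {u | 0 < inner ℝ (a q) (u - G q)} = {u | inner ℝ (a q) (G q) < innerSL ℝ (a q) u} := by
    ext u; simp [inner_sub_right]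
  rw [this]
  exact convex_halfSpace_gt (innerSL ℝ (a q)).isLinear _

variable {S : Type*} [TopologicalSpace S]

/-- The bounded open set `D` has the boundary `G(S)`, which is locally strictly convex with respect
to the normal vectors `a`; these are, up to a factor, the only vectors normal to a supporting
hyperplane of the boundary. -/
structure HasConvexBoundary (D : Set E) (G a : S → E) : Prop where
  isOpen : IsOpen D
  isConnected : IsConnected D
  isBounded : Bornology.IsBounded D
  continuous : Continuous G
  injective : Function.Injective G
  frontier_eq : frontier D = range G
  locally_convex : ∀ p, ∃ V ∈ 𝓝 p, ∃ b : S → E, ContinuousAt b p ∧ b p = a p ∧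
    ∀ q ∈ V, (∃ c : ℝ, b q = c • a q) ∧ ∀ q' ∈ V, q' ≠ q → inner ℝ (b q) (G q' - G q) < 0
  unique_normal : ∀ p (m : E), (∀ q, inner ℝ m (G q - G p) ≤ 0) → ∃ c : ℝ, m = c • a p

namespace HasConvexBoundary

variable {D : Set E} {G a : S → E}

theorem exists_nhds (h : HasConvexBoundary D G a) [∀ p : S, (𝓝[≠] p).NeBot] (p : S) :
    ∃ V, IsOpen V ∧ p ∈ V ∧ ∃ b : S → E, ContinuousAt b p ∧ b p = a p ∧
      ∀ q ∈ V, (∃ c : ℝ, 0 < c ∧ b q = c • a q) ∧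
        ∀ q' ∈ V, q' ≠ q → inner ℝ (a q) (G q' - G q) < 0 := by
  obtain ⟨V₀, hV₀, b, hb, hbp, H⟩ := h.locally_convex p
  obtain ⟨V, hVV, hVo, hpV⟩ := mem_nhds_iff.1 hV₀
  refine ⟨V, hVo, hpV, b, hb, hbp, fun q hq => ?_⟩
  obtain ⟨c, hc⟩ := (H q (hVV hq)).1
  have hcpos : 0 < c := by
    obtain ⟨W, hW, b', -, hb', H'⟩ := h.locally_convex q
    have h1 : ∀ᶠ q' in 𝓝[≠] q, q' ∈ V ∩ W :=
      nhdsWithin_le_nhds (inter_mem (hVo.mem_nhds hq) hW)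
    obtain ⟨q', hq', hne⟩ := (h1.and eventually_mem_nhdsWithin).exists
    have h2 := (H q (hVV hq)).2 q' (hVV hq'.1) hne
    have h3 := (H' q (mem_of_mem_nhds hW)).2 q' hq'.2 hne
    rw [hb'] at h3
    rw [hc, real_inner_smul_left] at h2
    by_contra hneg
    nlinarith
  refine ⟨⟨c, hcpos, hc⟩, fun q' hq' hne => ?_⟩
  have h2 := (H q (hVV hq)).2 q' (hVV hq') hne
  rw [hc, real_inner_smul_left] at h2
  by_contra hneg
  nlinarith

theorem normal_ne_zero (h : HasConvexBoundary D G a) [∀ p : S, (𝓝[≠] p).NeBot] (p : S) :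
    a p ≠ 0 := by
  obtain ⟨V, hVo, hpV, b, hb, hbp, H⟩ := h.exists_nhds p
  have h1 : ∀ᶠ q' in 𝓝[≠] p, q' ∈ V := nhdsWithin_le_nhds (hVo.mem_nhds hpV)
  obtain ⟨q', hq', hne⟩ := (h1.and eventually_mem_nhdsWithin).exists
  intro h0
  have := (H p hpV).2 q' hq' hne
  simp [h0] at this

theorem subset_or_disjoint_closure {E : Type*} [TopologicalSpace E] {D H : Set E}
    (hD : IsOpen D) (hH : IsPreconnected H) (hf : Disjoint H (frontier D)) :
    H ⊆ D ∨ Disjoint H (closure D) := by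
  have hcov : H ⊆ D ∪ (closure D)ᶜ := by
    intro u hu
    by_contra hcon
    simp only [mem_union, mem_compl_iff, not_or, not_not] at hcon
    exact disjoint_left.1 hf hu (by rw [hD.frontier_eq]; exact ⟨hcon.2, hcon.1⟩)
  rcases IsPreconnected.subset_or_subset hD isClosed_closure.isOpen_compl
    (disjoint_compl_right.mono_left subset_closure) hcov hH with h | h
  · exact Or.inl h
  · exact Or.inr (disjoint_left.2 fun u hu => h hu)

theorem eventually_mem_outerCap (h : HasConvexBoundary D G a) [∀ p : S, (𝓝[≠] p).NeBot]
    {p q : S} {δ : ℝ} (hq : G q ∈ Metric.ball (G p) δ) :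
    ∀ᶠ t in 𝓝[>] (0 : ℝ), G q + t • a q ∈ outerCap G a p δ q := by
  have h1 : ∀ᶠ t in 𝓝 (0 : ℝ), G q + t • a q ∈ Metric.ball (G p) δ := by
    have hc : ContinuousAt (fun t : ℝ => G q + t • a q) 0 := by fun_prop
    exact hc.eventually (Metric.isOpen_ball.mem_nhds (by simpa using hq))
  filter_upwards [nhdsWithin_le_nhds h1, eventually_mem_nhdsWithin] with t ht ht0
  refine ⟨ht, ?_⟩
  have := norm_pos_iff.2 (h.normal_ne_zero q)
  have ht0 : 0 < t := ht0
  simp only [mem_ofPred_eq, add_sub_cancel_left, real_inner_smul_right, real_inner_self_eq_norm_sq]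
  positivity

/-- Near `p` the boundary lies strictly on the negative side of each of its tangent hyperplanes,
and the positive sides are all in `D` or all disjoint from its closure. -/
theorem exists_ball (h : HasConvexBoundary D G a) [CompactSpace S] [∀ p : S, (𝓝[≠] p).NeBot]
    (p : S) : ∃ δ > 0,
      (∀ q', G q' ∈ Metric.ball (G p) δ → q' ≠ p → inner ℝ (a p) (G q' - G p) < 0) ∧
      ∀ᶠ q in 𝓝 p, G q ∈ Metric.ball (G p) δ ∧
        (outerCap G a p δ q ⊆ D ∨ Disjoint (outerCap G a p δ q) (closure D)) ∧
        (outerCap G a p δ p ∩ outerCap G a p δ q).Nonempty := by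
  obtain ⟨V, hVo, hpV, b, hb, hbp, H⟩ := h.exists_nhds p
  have hemb := h.continuous.isClosedEmbedding h.injective
  have hV : V ∈ comap G (𝓝 (G p)) := by
    rw [← hemb.isInducing.nhds_eq_comap]; exact hVo.mem_nhds hpV
  obtain ⟨W, hW, hWV⟩ := hV
  obtain ⟨δ, hδ, hδW⟩ := Metric.mem_nhds_iff.1 hW
  have hG : ∀ q', G q' ∈ Metric.ball (G p) δ → q' ∈ V := fun q' hq' => hWV (hδW hq')
  refine ⟨δ, hδ, fun q' hq' hne => (H p hpV).2 q' (hG q' hq') hne, ?_⟩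
  obtain ⟨t, ht⟩ := (h.eventually_mem_outerCap (Metric.mem_ball_self hδ : G p ∈ _)).exists
  have hball : ∀ᶠ q in 𝓝 p, G q ∈ Metric.ball (G p) δ :=
    h.continuous.continuousAt.eventually (Metric.isOpen_ball.mem_nhds (Metric.mem_ball_self hδ))
  have hpos : ∀ᶠ q in 𝓝 p, 0 < inner ℝ (b q) (G p + t • a p - G q) := by
    have hc : ContinuousAt (fun q => inner ℝ (b q) (G p + t • a p - G q)) p :=
      hb.inner (continuousAt_const.sub h.continuous.continuousAt)
    refine hc.eventually (lt_mem_nhds ?_)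
    simp only [hbp]
    exact ht.2
  filter_upwards [hball, hpos] with q hq hq'
  have hqV := hG q hq
  obtain ⟨⟨c, hc, hbc⟩, H2⟩ := H q hqV
  refine ⟨hq, subset_or_disjoint_closure h.isOpen (isPreconnected_outerCap _ _ _) ?_,
    G p + t • a p, ht, ht.1, ?_⟩
  · rw [h.frontier_eq]
    refine disjoint_left.2 ?_
    rintro _ ⟨h1, h2⟩ ⟨q', rfl⟩
    rcases eq_or_ne q' q with rfl | hne
    · simp at h2
    · exact lt_asymm h2 (H2 q' (hG q' h1) hne)
  · rw [hbc, real_inner_smul_left] at hq'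
    exact pos_of_mul_pos_right hq' hc.le

theorem inward_iff (h : HasConvexBoundary D G a) [∀ p : S, (𝓝[≠] p).NeBot]
    {p q : S} {δ : ℝ} (hq : G q ∈ Metric.ball (G p) δ)
    (hor : outerCap G a p δ q ⊆ D ∨ Disjoint (outerCap G a p δ q) (closure D)) :
    (∀ᶠ t in 𝓝[>] (0 : ℝ), G q + t • a q ∈ D) ↔ outerCap G a p δ q ⊆ D := by
  have hev := h.eventually_mem_outerCap hq
  constructor
  · intro h1
    obtain ⟨t, h2, h3⟩ := (hev.and h1).exists
    exact hor.resolve_right fun hd => disjoint_left.1 hd h2 (subset_closure h3)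
  · exact fun h1 => hev.mono fun t ht => h1 ht

theorem isClopen_inward (h : HasConvexBoundary D G a) [CompactSpace S]
    [∀ p : S, (𝓝[≠] p).NeBot] :
    IsClopen {p | ∀ᶠ t in 𝓝[>] (0 : ℝ), G p + t • a p ∈ D} := by
  have key : ∀ p, ∀ᶠ q in 𝓝 p, ((∀ᶠ t in 𝓝[>] (0 : ℝ), G q + t • a q ∈ D) ↔
      ∀ᶠ t in 𝓝[>] (0 : ℝ), G p + t • a p ∈ D) := by
    intro p
    obtain ⟨δ, hδ, -, H⟩ := h.exists_ball p
    obtain ⟨hp1, hp2, -⟩ := H.self_of_nhds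
    filter_upwards [H] with q hq
    obtain ⟨hq1, hq2, u, hup, huq⟩ := hq
    rw [h.inward_iff hq1 hq2, h.inward_iff hp1 hp2]
    constructor
    · exact fun h1 => hp2.resolve_right fun hd => disjoint_left.1 hd hup (subset_closure (h1 huq))
    · exact fun h1 => hq2.resolve_right fun hd => disjoint_left.1 hd huq (subset_closure (h1 hup))
  constructor
  · rw [← isOpen_compl_iff, isOpen_iff_mem_nhds]
    intro p hp
    filter_upwards [key p] with q hq
    exact fun hcon => hp (hq.1 hcon)
  · rw [isOpen_iff_mem_nhds]
    intro p hp
    filter_upwards [key p] with q hq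
    exact hq.2 hp

theorem exists_not_inward (h : HasConvexBoundary D G a) [CompactSpace S] [ProperSpace E]
    [Nontrivial E] [∀ p : S, (𝓝[≠] p).NeBot] :
    ∃ p, ¬ ∀ᶠ t in 𝓝[>] (0 : ℝ), G p + t • a p ∈ D := by
  obtain ⟨m, hm⟩ := exists_ne (0 : E)
  have hcpt : IsCompact (closure D) := h.isBounded.isCompact_closure
  obtain ⟨u, hu, hmax⟩ := hcpt.exists_isMaxOn (h.isConnected.nonempty.mono subset_closure)
    (f := fun u => inner ℝ m u) (by fun_prop)
  have hmax : ∀ v ∈ closure D, inner ℝ m v ≤ inner ℝ m u := hmax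
  have huD : u ∉ D := by
    intro huD
    have hc : ContinuousAt (fun t : ℝ => u + t • m) 0 := by fun_prop
    have h1 : ∀ᶠ t in 𝓝 (0 : ℝ), u + t • m ∈ D :=
      hc.eventually (h.isOpen.mem_nhds (by simpa using huD))
    obtain ⟨t, ht, ht0⟩ := ((h1.filter_mono nhdsWithin_le_nhds).and
      (eventually_mem_nhdsWithin (s := Ioi (0 : ℝ)))).exists
    have h2 := hmax _ (subset_closure ht)
    have hmp := norm_pos_iff.2 hm
    have ht0 : 0 < t := ht0
    rw [inner_add_right, real_inner_smul_right, real_inner_self_eq_norm_sq] at h2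
    have : 0 < t * ‖m‖ ^ 2 := by positivity
    linarith
  have huf : u ∈ frontier D := by rw [h.isOpen.frontier_eq]; exact ⟨hu, huD⟩
  rw [h.frontier_eq] at huf
  obtain ⟨p, rfl⟩ := huf
  refine ⟨p, fun hin => ?_⟩
  have hG : ∀ q, G q ∈ closure D := fun q =>
    frontier_subset_closure (by rw [h.frontier_eq]; exact mem_range_self q)
  obtain ⟨c, hc⟩ := h.unique_normal p m fun q => by
    rw [inner_sub_right]; linarith [hmax _ (hG q)]
  have hap := norm_pos_iff.2 (h.normal_ne_zero p)
  have hcneg : c ≤ 0 := by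
    obtain ⟨t, ht, ht0⟩ := (hin.and (eventually_mem_nhdsWithin (s := Ioi (0 : ℝ)))).exists
    have ht0 : 0 < t := ht0
    have h2 := hmax _ (subset_closure ht)
    rw [hc, inner_add_right, real_inner_smul_right, real_inner_smul_left (a p) (a p),
      real_inner_self_eq_norm_sq] at h2
    by_contra hcc
    have : 0 < t * (c * ‖a p‖ ^ 2) := by have := not_le.1 hcc; positivity
    linarith
  obtain ⟨V, hVo, hpV, b, hb, hbp, H⟩ := h.exists_nhds p
  have h1 : ∀ᶠ q' in 𝓝[≠] p, q' ∈ V := nhdsWithin_le_nhds (hVo.mem_nhds hpV)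
  obtain ⟨q', hq', hne⟩ := (h1.and eventually_mem_nhdsWithin).exists
  have h2 := (H p hpV).2 q' hq' hne
  have h3 := hmax _ (hG q')
  have h4 : inner ℝ m (G q' - G p) ≤ 0 := by rw [inner_sub_right]; linarith
  rw [hc, real_inner_smul_left] at h4
  have : c = 0 := by
    by_contra hc0
    have : c < 0 := lt_of_le_of_ne hcneg hc0
    nlinarith
  exact hm (by rw [hc, this, zero_smul])

/-- Every boundary point has a strict local support hyperplane. -/
theorem local_support (h : HasConvexBoundary D G a) [CompactSpace S] [ProperSpace E]
    [Nontrivial E] [PreconnectedSpace S] [∀ p : S, (𝓝[≠] p).NeBot] (p : S) :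
    ∃ δ > 0, ∀ u ∈ closure D, u ∈ Metric.ball (G p) δ → u ≠ G p →
      inner ℝ (a p) (u - G p) < 0 := by
  have hp : ¬ ∀ᶠ t in 𝓝[>] (0 : ℝ), G p + t • a p ∈ D := by
    rcases isClopen_iff.1 h.isClopen_inward with h0 | h1
    · exact fun hp => (eq_empty_iff_forall_notMem.1 h0 p) hp
    · obtain ⟨q, hq⟩ := h.exists_not_inward
      exact absurd (eq_univ_iff_forall.1 h1 q) hq
  obtain ⟨δ, hδ, hneg, H⟩ := h.exists_ball p
  obtain ⟨hp1, hp2, -⟩ := H.self_of_nhds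
  rw [h.inward_iff hp1 hp2] at hp
  have hdisj := hp2.resolve_left hp
  refine ⟨δ, hδ, fun u hu hub hne => ?_⟩
  by_contra hcon
  rcases (not_lt.1 hcon).lt_or_eq with hlt | heq
  · exact disjoint_left.1 hdisj ⟨hub, hlt⟩ hu
  by_cases huD : u ∈ D
  · have hc : ContinuousAt (fun t : ℝ => u + t • a p) 0 := by fun_prop
    have h1 : ∀ᶠ t in 𝓝 (0 : ℝ), u + t • a p ∈ D ∩ Metric.ball (G p) δ :=
      hc.eventually ((h.isOpen.inter Metric.isOpen_ball).mem_nhds (by simpa using ⟨huD, hub⟩))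
    obtain ⟨t, ht, ht0⟩ := ((h1.filter_mono nhdsWithin_le_nhds).and
      (eventually_mem_nhdsWithin (s := Ioi (0 : ℝ)))).exists
    have ht0 : 0 < t := ht0
    have hap := norm_pos_iff.2 (h.normal_ne_zero p)
    refine disjoint_left.1 hdisj ⟨ht.2, ?_⟩ (subset_closure ht.1)
    rw [mem_ofPred_eq, add_sub_right_comm, inner_add_right, ← heq, real_inner_smul_right,
      real_inner_self_eq_norm_sq]
    positivity
  · have huf : u ∈ frontier D := by rw [h.isOpen.frontier_eq]; exact ⟨hu, huD⟩
    rw [h.frontier_eq] at huf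
    obtain ⟨q, rfl⟩ := huf
    have := hneg q hub (fun hqp => hne (by rw [hqp]))
    linarith

theorem segment_subset (h : HasConvexBoundary D G a) [CompactSpace S] [ProperSpace E]
    [Nontrivial E] [PreconnectedSpace S] [∀ p : S, (𝓝[≠] p).NeBot] {w : E} (hw : w ∈ D) :
    D ⊆ {u | ∀ t ∈ Icc (0 : ℝ) 1, w + t • (u - w) ∈ D} := by
  refine h.isConnected.isPreconnected.subset_of_closure_inter_subset ?_ ⟨w, hw, by simp [hw]⟩ ?_
  · rw [isOpen_iff_mem_nhds]
    intro u hu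
    refine isCompact_Icc.eventually_forall_of_forall_eventually
      (P := fun u (t : ℝ) => w + t • (u - w) ∈ D) fun t ht => ?_
    have hc : ContinuousAt (fun z : E × ℝ => w + z.2 • (z.1 - w)) (u, t) := by fun_prop
    exact hc.eventually (h.isOpen.mem_nhds (hu t ht))
  · rintro u ⟨hu, huD⟩ t ht
    have hcl : ∀ t ∈ Icc (0 : ℝ) 1, w + t • (u - w) ∈ closure D := by
      intro t ht
      have hcont : Continuous fun v : E => w + t • (v - w) := by fun_prop
      exact map_mem_closure (f := fun v : E => w + t • (v - w)) hcont hu fun v hv => hv t ht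
    by_contra hcon
    have hf : w + t • (u - w) ∈ frontier D := by
      rw [h.isOpen.frontier_eq]; exact ⟨hcl t ht, hcon⟩
    rw [h.frontier_eq] at hf
    obtain ⟨p, hp⟩ := hf
    have huw : u - w ≠ 0 := fun h0 => hcon (by simp [h0, hw])
    have ht0 : 0 < t := lt_of_le_of_ne ht.1 fun h0 => hcon (by simp [← h0, hw])
    have ht1 : t < 1 := lt_of_le_of_ne ht.2 fun h0 => hcon (by simp [h0, huD])
    obtain ⟨δ, hδ, H⟩ := h.local_support p
    have hev : ∀ᶠ s in 𝓝 t, s ∈ Ioo (0 : ℝ) 1 ∧ w + s • (u - w) ∈ Metric.ball (G p) δ := by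
      have hc : ContinuousAt (fun s : ℝ => w + s • (u - w)) t := by fun_prop
      exact Eventually.and (Ioo_mem_nhds ht0 ht1) (hc.eventually (Metric.isOpen_ball.mem_nhds (by
        rw [hp]; exact Metric.mem_ball_self hδ)))
    have hdiff : ∀ s, w + s • (u - w) - G p = (s - t) • (u - w) := by
      intro s; rw [hp, sub_smul]; abel
    have hside : ∀ s, s ∈ Ioo (0 : ℝ) 1 ∧ w + s • (u - w) ∈ Metric.ball (G p) δ → s ≠ t →
        (s - t) * inner ℝ (a p) (u - w) < 0 := by
      intro s hs hst
      have := H _ (hcl s (Ioo_subset_Icc_self hs.1)) hs.2 (fun h0 => by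
        have h1 := hdiff s
        rw [h0, sub_self] at h1
        exact (smul_ne_zero (sub_ne_zero.2 hst) huw) h1.symm)
      rwa [hdiff, real_inner_smul_right] at this
    obtain ⟨s₁, hs₁, hlt₁⟩ := ((hev.filter_mono nhdsWithin_le_nhds).and
      (eventually_mem_nhdsWithin (s := Ioi t))).exists
    obtain ⟨s₂, hs₂, hlt₂⟩ := ((hev.filter_mono nhdsWithin_le_nhds).and
      (eventually_mem_nhdsWithin (s := Iio t))).exists
    have hlt₁ : t < s₁ := hlt₁
    have hlt₂ : s₂ < t := hlt₂
    have h1 := hside s₁ hs₁ hlt₁.ne'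
    have h2 := hside s₂ hs₂ hlt₂.ne
    nlinarith

theorem convex (h : HasConvexBoundary D G a) [CompactSpace S] [ProperSpace E]
    [Nontrivial E] [PreconnectedSpace S] [∀ p : S, (𝓝[≠] p).NeBot] : Convex ℝ D := by
  rw [convex_iff_segment_subset]
  intro w hw u hu
  rw [segment_eq_image']
  rintro _ ⟨t, ht, rfl⟩
  exact h.segment_subset hw hu t ht

/-- The domain lies on the negative side of every tangent hyperplane of its boundary. -/
theorem support (h : HasConvexBoundary D G a) [CompactSpace S] [ProperSpace E]
    [Nontrivial E] [PreconnectedSpace S] [∀ p : S, (𝓝[≠] p).NeBot] (p : S) {w : E} (hw : w ∈ D) :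
    inner ℝ (a p) (w - G p) < 0 := by
  obtain ⟨δ, hδ, H⟩ := h.local_support p
  have hpf : G p ∈ frontier D := by rw [h.frontier_eq]; exact mem_range_self p
  have hne : w - G p ≠ 0 := by
    intro h0
    rw [h.isOpen.frontier_eq] at hpf
    exact hpf.2 (by rwa [sub_eq_zero.1 h0] at hw)
  have hev : ∀ᶠ s in 𝓝 (0 : ℝ), G p + s • (w - G p) ∈ Metric.ball (G p) δ := by
    have hc : ContinuousAt (fun s : ℝ => G p + s • (w - G p)) 0 := by fun_prop
    exact hc.eventually (Metric.isOpen_ball.mem_nhds (by simpa using hδ))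
  obtain ⟨s, hs, hs01⟩ := ((hev.filter_mono nhdsWithin_le_nhds).and
    (Ioo_mem_nhdsGT (zero_lt_one' ℝ))).exists
  have hmem : G p + s • (w - G p) ∈ closure D := by
    refine (convex_iff_segment_subset.1 h.convex.closure) (frontier_subset_closure hpf)
      (subset_closure hw) ?_
    rw [segment_eq_image']
    exact ⟨s, Ioo_subset_Icc_self hs01, rfl⟩
  have h1 := H _ hmem hs (by simp [hs01.1.ne', hne])
  rw [add_sub_cancel_left, real_inner_smul_right] at h1
  by_contra hcon
  nlinarith [hs01.1]

/-- A direction that leaves the domain at a boundary point is on the positive side. -/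
theorem nonneg_of_exits (h : HasConvexBoundary D G a) [CompactSpace S] [ProperSpace E]
    [Nontrivial E] [PreconnectedSpace S] [∀ p : S, (𝓝[≠] p).NeBot] (p : S) {e : E}
    (he : ∃ᶠ t in 𝓝[>] (0 : ℝ), G p + t • e ∉ D) : 0 ≤ inner ℝ (a p) e := by
  by_contra hneg
  have hpf : G p ∈ frontier D := by rw [h.frontier_eq]; exact mem_range_self p
  have hpc := frontier_subset_closure hpf
  have hray : ∀ t : ℝ, 0 < t → G p + t • e ∉ D := by
    intro t ht hmem
    refine he ?_
    filter_upwards [Ioo_mem_nhdsGT ht] with s hs hsD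
    refine hsD (interior_subset (h.convex.openSegment_closure_interior_subset_interior hpc
      (by rwa [h.isOpen.interior_eq]) ?_))
    rw [openSegment_eq_image']
    refine ⟨s / t, ⟨div_pos hs.1 ht, (div_lt_one ht).2 hs.2⟩, ?_⟩
    simp only [add_sub_cancel_left, smul_smul]
    rw [div_mul_cancel₀ _ ht.ne']
  have hconv : Convex ℝ ((fun t : ℝ => G p + t • e) '' Ioi 0) := by
    rintro _ ⟨s, hs, rfl⟩ _ ⟨t, ht, rfl⟩ α β hα hβ hαβ
    refine ⟨α * s + β * t, ?_, ?_⟩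
    · exact (convex_Ioi (0 : ℝ)) hs ht hα hβ hαβ
    · have : G p = α • G p + β • G p := by rw [← add_smul, hαβ, one_smul]
      simp only [smul_add, add_smul, smul_smul]
      nth_rewrite 1 [this]
      abel
  obtain ⟨f, u, hfD, hfray⟩ := geometric_hahn_banach_open h.convex h.isOpen hconv
    (disjoint_left.2 (by rintro _ h1 ⟨t, ht, rfl⟩; exact hray t ht h1))
  have hcl : ∀ v ∈ closure D, f v ≤ u := fun v hv =>
    closure_minimal (fun v hv => (hfD v hv).le) (isClosed_le f.continuous continuous_const) hv
  have hray' : ∀ t : ℝ, 0 < t → u ≤ f (G p) + t * f e := by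
    intro t ht
    have := hfray _ ⟨t, ht, rfl⟩
    simpa using this
  have hfp : u ≤ f (G p) := by
    have ht : Tendsto (fun t : ℝ => f (G p) + t * f e) (𝓝[>] 0) (𝓝 (f (G p))) := by
      have hc : ContinuousAt (fun t : ℝ => f (G p) + t * f e) 0 := by fun_prop
      simpa using hc.tendsto.mono_left nhdsWithin_le_nhds
    exact ge_of_tendsto ht (eventually_mem_nhdsWithin.mono fun t ht => hray' t ht)
  have hfeq : f (G p) = u := le_antisymm (hcl _ hpc) hfp
  have hfe : 0 ≤ f e := by have := hray' 1 one_pos; linarith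
  set m := (InnerProductSpace.toDual ℝ E).symm f with hm
  have hmf : ∀ v, inner ℝ m v = f v := fun v => InnerProductSpace.toDual_symm_apply
  obtain ⟨c, hc⟩ := h.unique_normal p m fun q => by
    rw [hmf, map_sub, hfeq]
    have := hcl (G q) (frontier_subset_closure (by rw [h.frontier_eq]; exact mem_range_self q))
    linarith
  obtain ⟨w, hw⟩ := h.isConnected.nonempty
  have h1 := h.support p hw
  have h2 : c * inner ℝ (a p) (w - G p) < 0 := by
    rw [← real_inner_smul_left, ← hc, hmf, map_sub, hfeq]
    linarith [hfD w hw]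
  have h3 : 0 ≤ c * inner ℝ (a p) e := by
    rw [← real_inner_smul_left, ← hc, hmf]; exact hfe
  have h4 : 0 < c := by by_contra hcc; nlinarith
  nlinarith

end HasConvexBoundary

end Euclidean

end HypFoliation

noncomputable section

namespace HypFoliation

/-! ### Algebra of the Lorentz form -/

section Lorentz

variable {n : ℕ}

theorem lorentz_comm (v w : Mink n) : lorentz v w = lorentz w v := by
  simp only [lorentz, real_inner_comm w.1 v.1, mul_comm v.2]

theorem lorentz_add_left (u v w : Mink n) : lorentz (u + v) w = lorentz u w + lorentz v w := by
  simp only [lorentz, Prod.fst_add, Prod.snd_add, inner_add_left]; ring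

theorem lorentz_smul_left (c : ℝ) (v w : Mink n) : lorentz (c • v) w = c * lorentz v w := by
  simp only [lorentz, Prod.smul_fst, Prod.smul_snd, real_inner_smul_left, smul_eq_mul]; ring

/-- The Lorentz form as a bilinear map. -/
def lorentzBilin (n : ℕ) : Mink n →ₗ[ℝ] Mink n →ₗ[ℝ] ℝ :=
  LinearMap.mk₂ ℝ lorentz lorentz_add_left lorentz_smul_left
    (fun u v w => by rw [lorentz_comm, lorentz_add_left, lorentz_comm v, lorentz_comm w])
    (fun c v w => by rw [lorentz_comm, lorentz_smul_left, lorentz_comm w, smul_eq_mul])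

theorem lorentz_add_right (u v w : Mink n) : lorentz u (v + w) = lorentz u v + lorentz u w :=
  map_add (lorentzBilin n u) v w

theorem lorentz_smul_right (c : ℝ) (v w : Mink n) : lorentz v (c • w) = c * lorentz v w :=
  map_smul (lorentzBilin n v) c w

theorem lorentz_sub_right (u v w : Mink n) : lorentz u (v - w) = lorentz u v - lorentz u w :=
  map_sub (lorentzBilin n u) v w

theorem lorentz_sub_left (u v w : Mink n) : lorentz (u - v) w = lorentz u w - lorentz v w := by
  rw [lorentz_comm, lorentz_sub_right, lorentz_comm w, lorentz_comm w]

theorem lorentz_neg_right (v w : Mink n) : lorentz v (-w) = -lorentz v w :=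
  map_neg (lorentzBilin n v) w

theorem lorentz_neg_left (v w : Mink n) : lorentz (-v) w = -lorentz v w := by
  rw [lorentz_comm, lorentz_neg_right, lorentz_comm]

theorem lorentz_zero_right (v : Mink n) : lorentz v 0 = 0 := map_zero (lorentzBilin n v)

theorem lorentz_sum_right {ι : Type*} (s : Finset ι) (v : Mink n) (w : ι → Mink n) :
    lorentz v (∑ i ∈ s, w i) = ∑ i ∈ s, lorentz v (w i) :=
  map_sum (lorentzBilin n v) w s

theorem lorentz_sum_left {ι : Type*} (s : Finset ι) (v : Mink n) (w : ι → Mink n) :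
    lorentz (∑ i ∈ s, w i) v = ∑ i ∈ s, lorentz (w i) v := by
  simp only [lorentz_comm _ v, lorentz_sum_right]

theorem contDiff_lorentz {m : WithTop ℕ∞} :
    ContDiff ℝ m fun p : Mink n × Mink n => lorentz p.1 p.2 := by
  unfold lorentz
  exact (contDiff_fst.fst.inner ℝ contDiff_snd.fst).sub (contDiff_fst.snd.mul contDiff_snd.snd)

theorem continuous_lorentz : Continuous fun v : Mink n => lorentz v v := by
  unfold lorentz
  fun_prop

theorem fderiv_lorentz_apply {V : Type*} [NormedAddCommGroup V] [NormedSpace ℝ V]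
    {u w : V → Mink n} {u' w' : V →L[ℝ] Mink n} {x : V} (hu : HasFDerivAt u u' x)
    (hw : HasFDerivAt w w' x) (v : V) :
    fderiv ℝ (fun z => lorentz (u z) (w z)) x v =
      lorentz (u' v) (w x) + lorentz (u x) (w' v) := by
  have h := (hu.fst.inner ℝ hw.fst).sub (hu.snd.mul hw.snd)
  have h' : HasFDerivAt (fun z => lorentz (u z) (w z)) _ x := h
  rw [h'.fderiv]
  simp [lorentz, fderivInnerCLM_apply]
  ring

theorem eq_zero_of_lorentz_eq_zero {Z : Mink n} (h : ∀ W, lorentz Z W = 0) : Z = 0 := by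
  have h1 := h (Z.1, -Z.2)
  simp only [lorentz, real_inner_self_eq_norm_sq] at h1
  have h2 : Z.2 = 0 := by nlinarith [sq_nonneg ‖Z.1‖]
  have h3 : ‖Z.1‖ = 0 := by rw [h2] at h1; nlinarith [sq_nonneg ‖Z.1‖]
  exact Prod.ext (norm_eq_zero.1 h3) h2

/-- A nonzero vector orthogonal to a timelike one is spacelike. -/
theorem lorentz_self_pos {X Z : Mink n} (hX : lorentz X X < 0) (h : lorentz X Z = 0)
    (hZ : Z ≠ 0) : 0 < lorentz Z Z := by
  simp only [lorentz, real_inner_self_eq_norm_sq] at *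
  have hcs := real_inner_mul_inner_self_le X.1 Z.1
  simp only [real_inner_self_eq_norm_sq] at hcs
  have h1 : inner ℝ X.1 Z.1 = X.2 * Z.2 := by linarith
  rw [h1] at hcs
  have hx2 : 0 < X.2 * X.2 := by nlinarith [sq_nonneg ‖X.1‖]
  rcases eq_or_ne Z.1 0 with h0 | h0
  · rw [h0, norm_zero] at hcs
    have : Z.2 = 0 := by
      by_contra hne
      have : 0 < Z.2 * Z.2 := mul_self_pos.2 hne
      nlinarith
    exact absurd (Prod.ext h0 this) hZ
  · have hz : 0 < ‖Z.1‖ ^ 2 := by have := norm_pos_iff.2 h0; positivity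
    by_contra hcon
    nlinarith

/-- A vector orthogonal to a point of a hypersurface, to the tangent space and to the normal
vector vanishes. -/
theorem eq_zero_of_orthogonal_frame {V : Type*} [NormedAddCommGroup V] [NormedSpace ℝ V]
    [FiniteDimensional ℝ V] (hV : Module.finrank ℝ V + 1 = n) {X N : Mink n} (L : V →ₗ[ℝ] Mink n)
    (hL : Function.Injective L) (hX : lorentz X X < 0) (hN : lorentz N N = 1)
    (hNX : lorentz N X = 0) (hXL : ∀ v, lorentz X (L v) = 0) (hNL : ∀ v, lorentz N (L v) = 0)
    {Z : Mink n} (hZX : lorentz Z X = 0) (hZN : lorentz Z N = 0)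
    (hZL : ∀ v, lorentz Z (L v) = 0) : Z = 0 := by
  let T : V × ℝ × ℝ →ₗ[ℝ] Mink n :=
    L.coprod ((LinearMap.toSpanSingleton ℝ _ X).coprod (LinearMap.toSpanSingleton ℝ _ N))
  have hT : ∀ v a b, T (v, a, b) = L v + (a • X + b • N) := fun v a b => by simp [T]
  have hinj : Function.Injective T := by
    rw [← LinearMap.ker_eq_bot, LinearMap.ker_eq_bot']
    rintro ⟨v, a, b⟩ h0
    rw [hT] at h0
    have h1 : lorentz X (L v + (a • X + b • N)) = 0 := by rw [h0, lorentz_zero_right]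
    have h2 : lorentz N (L v + (a • X + b • N)) = 0 := by rw [h0, lorentz_zero_right]
    simp only [lorentz_add_right, lorentz_smul_right, hXL, hNL, hN, hNX, lorentz_comm X N] at h1 h2
    have ha : a = 0 := by
      have : a * lorentz X X = 0 := by linarith
      exact (mul_eq_zero.1 this).resolve_right hX.ne
    have hb : b = 0 := by linarith
    rw [ha, hb] at h0
    have hv : L v = L 0 := by simpa using h0
    rw [hL hv, ha, hb]; rfl
  have hsurj : Function.Surjective T := by
    refine (LinearMap.injective_iff_surjective_of_finrank_eq_finrank ?_).1 hinj
    simp only [Module.finrank_prod, Module.finrank_self, finrank_euclideanSpace, Fintype.card_fin]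
    omega
  refine eq_zero_of_lorentz_eq_zero fun W => ?_
  obtain ⟨⟨v, a, b⟩, rfl⟩ := hsurj W
  rw [hT]
  simp only [lorentz_add_right, lorentz_smul_right, hZX, hZN, hZL]
  ring

end Lorentz

/-! ### Polar coordinates along a geodesic -/

section Polar

variable {n : ℕ} {k : ℝ}

theorem Hyp.norm_sq (hk : 0 < k) {X : Mink n} (hX : X ∈ Hyp n k) :
    (k * ‖X.1‖) ^ 2 = (k * X.2) ^ 2 - 1 := by
  have h1 := hX.1
  rw [lorentz, real_inner_self_eq_norm_sq] at h1
  have : ‖X.1‖ ^ 2 = X.2 ^ 2 - 1 / k ^ 2 := by linarith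
  rw [mul_pow, this]
  field_simp

theorem Hyp.one_le (hk : 0 < k) {X : Mink n} (hX : X ∈ Hyp n k) : 1 ≤ k * X.2 := by
  have h := Hyp.norm_sq hk hX
  have : 0 < k * X.2 := mul_pos hk hX.2
  nlinarith [sq_nonneg (k * ‖X.1‖)]

theorem mul_radius (hk : 0 < k) (X : Mink n) : k * radius k X = Real.arcosh (k * X.2) := by
  rw [radius]; field_simp

theorem cosh_mul_radius (hk : 0 < k) {X : Mink n} (hX : X ∈ Hyp n k) :
    Real.cosh (k * radius k X) = k * X.2 := by
  rw [mul_radius hk, Real.cosh_arcosh (Hyp.one_le hk hX)]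

theorem sinh_mul_radius (hk : 0 < k) {X : Mink n} (hX : X ∈ Hyp n k) :
    Real.sinh (k * radius k X) = k * ‖X.1‖ := by
  rw [mul_radius hk, Real.sinh_arcosh (Hyp.one_le hk hX), ← Hyp.norm_sq hk hX,
    Real.sqrt_sq (by positivity)]

theorem radius_nonneg (hk : 0 < k) {X : Mink n} (hX : X ∈ Hyp n k) : 0 ≤ radius k X :=
  div_nonneg (Real.arcosh_nonneg (Hyp.one_le hk hX)) hk.le

theorem radius_lt_iff (hk : 0 < k) {X : Mink n} (hX : X ∈ Hyp n k) {R : ℝ} (hR : 0 ≤ R) :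
    radius k X < R ↔ k * X.2 < Real.cosh (k * R) := by
  have h0 := radius_nonneg hk hX
  rw [← cosh_mul_radius hk hX, Real.cosh_lt_cosh, abs_of_nonneg (by positivity),
    abs_of_nonneg (by positivity), mul_lt_mul_iff_right₀ hk]

/-- If `w` moves on the sphere of squared radius `s²` with `⟪w, w'⟫ = c`, the inner product of the
unit vector `w / s` with a unit vector `y` changes at a rate bounded by the tangential part
of `w'`. -/
theorem sq_deriv_angular_le {E : Type*} [NormedAddCommGroup E] [InnerProductSpace ℝ E]
    {w w' y : E} {s : ℝ} (hs : 0 < s) (hw : ‖w‖ = s) (hy : ‖y‖ = 1) :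
    ((inner ℝ w' y - inner ℝ w y * inner ℝ w w' / s ^ 2) / s) ^ 2 ≤
      (1 - (inner ℝ w y / s) ^ 2) * ((‖w'‖ ^ 2 - inner ℝ w w' ^ 2 / s ^ 2) / s ^ 2) := by
  have hcs := real_inner_mul_inner_self_le (w' - (inner ℝ w w' / s ^ 2) • w)
    (y - (inner ℝ w y / s ^ 2) • w)
  have hww : inner ℝ w w = s ^ 2 := by rw [real_inner_self_eq_norm_sq, hw]
  have hyy : inner ℝ y y = (1 : ℝ) := by rw [real_inner_self_eq_norm_sq, hy]; norm_num
  simp only [inner_sub_left, inner_sub_right, real_inner_smul_left, real_inner_smul_right, hww,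
    hyy, real_inner_comm w w', real_inner_comm w y, real_inner_self_eq_norm_sq w'] at hcs
  rw [div_pow, div_le_iff₀ (by positivity)]
  generalize inner ℝ w w' = A at *
  generalize inner ℝ w' y = B at *
  generalize inner ℝ w y = C at *
  generalize ‖w'‖ ^ 2 = M at *
  refine (le_of_eq ?_).trans (hcs.trans_eq ?_)
  · field_simp; ring
  · field_simp; ring

theorem hasDerivAt_inner_div_norm {E : Type*} [NormedAddCommGroup E] [InnerProductSpace ℝ E]
    {w : ℝ → E} {w' y : E} {ρ : ℝ} (h : HasDerivAt w w' ρ) (h0 : w ρ ≠ 0) :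
    HasDerivAt (fun t => inner ℝ (w t) y / ‖w t‖)
      ((inner ℝ w' y - inner ℝ (w ρ) y * inner ℝ (w ρ) w' / ‖w ρ‖ ^ 2) / ‖w ρ‖) ρ := by
  have hpos := norm_pos_iff.2 h0
  have hn : HasDerivAt (fun t => ‖w t‖) (inner ℝ (w ρ) w' / ‖w ρ‖) ρ := by
    have h1 := h.norm_sq.sqrt (by positivity)
    simp only [Real.sqrt_sq (norm_nonneg _)] at h1
    refine h1.congr_deriv ?_
    rw [mul_div_mul_left _ _ two_ne_zero]
  refine ((h.inner ℝ (hasDerivAt_const ρ y)).div hn hpos.ne').congr_deriv ?_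
  simp only [inner_zero_right, zero_add]
  field_simp

theorem lorentz_self (v : Mink n) : lorentz v v = ‖v.1‖ ^ 2 - v.2 ^ 2 := by
  rw [lorentz, real_inner_self_eq_norm_sq]; ring

theorem sinh_mul_radius_pos (hk : 0 < k) {X : Mink n} (h1 : 1 < k * X.2) :
    0 < Real.sinh (k * radius k X) := by
  rw [mul_radius hk, Real.sinh_arcosh h1.le]
  exact Real.sqrt_pos.2 (by nlinarith)

theorem hasDerivAt_radius (hk : 0 < k) {X : ℝ → Mink n} {V : Mink n} {ρ : ℝ}
    (h : HasDerivAt X V ρ) (h1 : 1 < k * (X ρ).2) :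
    HasDerivAt (fun t => radius k (X t)) (V.2 / Real.sinh (k * radius k (X ρ))) ρ := by
  have h2 : HasDerivAt (fun t => k * (X t).2) (k * V.2) ρ :=
    ((ContinuousLinearMap.snd ℝ (EuclideanSpace ℝ (Fin n)) ℝ).hasFDerivAt.comp_hasDerivAt
      ρ h).const_mul k
  have hs := sinh_mul_radius_pos hk h1
  refine (((Real.hasDerivAt_arcosh (x := k * (X ρ).2) h1).comp ρ h2).div_const k).congr_deriv ?_
  rw [mul_radius hk, Real.sinh_arcosh h1.le]
  rw [mul_radius hk, Real.sinh_arcosh h1.le] at hs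
  field_simp

/-- Along a unit speed curve the spherical coordinates change at a rate that is controlled by
the radial velocity. -/
theorem hasDerivAt_angular (hk : 0 < k) {X : ℝ → Mink n} {V : Mink n} {ρ : ℝ}
    (h : HasDerivAt X V ρ) (hX : X ρ ∈ Hyp n k) (h1 : 1 < k * (X ρ).2) (hV : lorentz V V = 1)
    (hXV : lorentz (X ρ) V = 0) {y : EuclideanSpace ℝ (Fin n)} (hy : ‖y‖ = 1) :
    ∃ D, HasDerivAt (fun t => ∑ i, angular (X t) i * y i) D ρ ∧
      D ^ 2 ≤ (1 - (∑ i, angular (X ρ) i * y i) ^ 2) *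
        (k ^ 2 * (1 - (V.2 / Real.sinh (k * radius k (X ρ))) ^ 2) /
          Real.sinh (k * radius k (X ρ)) ^ 2) ∧
      (∑ i, angular (X ρ) i * y i) ^ 2 ≤ 1 := by
  have hs := sinh_mul_radius_pos hk h1
  have hnsq := Hyp.norm_sq hk hX
  rw [sinh_mul_radius hk hX] at hs ⊢
  have hn : 0 < ‖(X ρ).1‖ := pos_of_mul_pos_right hs hk.le
  have h2 : HasDerivAt (fun t => (X t).1) V.1 ρ :=
    (ContinuousLinearMap.fst ℝ (EuclideanSpace ℝ (Fin n)) ℝ).hasFDerivAt.comp_hasDerivAt ρ h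
  have hφ : ∀ t, ∑ i, angular (X t) i * y i = inner ℝ (X t).1 y / ‖(X t).1‖ := by
    intro t
    rw [div_eq_inv_mul, ← real_inner_smul_left, ← angular, PiLp.inner_apply]
    exact Finset.sum_congr rfl fun i _ => by simp [mul_comm]
  simp only [hφ]
  refine ⟨_, hasDerivAt_inner_div_norm h2 (norm_pos_iff.1 hn), ?_, ?_⟩
  · refine (sq_deriv_angular_le (w' := V.1) hn rfl hy).trans_eq ?_
    congr 1
    rw [lorentz_self] at hV
    rw [lorentz] at hXV
    have e1 : ‖V.1‖ ^ 2 = 1 + V.2 ^ 2 := by linarith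
    have e2 : inner ℝ (X ρ).1 V.1 = (X ρ).2 * V.2 := by linarith
    rw [e1, e2]
    generalize ‖(X ρ).1‖ = s at *
    generalize (X ρ).2 = u at *
    field_simp
    linear_combination V.2 ^ 2 * hnsq
  · have h3 := abs_real_inner_le_norm (X ρ).1 y
    rw [hy, mul_one] at h3
    rw [sq_le_one_iff_abs_le_one, abs_div, abs_norm]
    exact div_le_one_of_le₀ h3 hn.le

variable {F N : Mink n}

/-- The geodesic with initial point `F` and initial velocity `N`. -/
def geodesic (k : ℝ) (F N : Mink n) (ρ : ℝ) : Mink n :=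
  Real.cosh (k * ρ) • F + ((1 / k) * Real.sinh (k * ρ)) • N

/-- The velocity of `geodesic k F N`. -/
def geodesicVelocity (k : ℝ) (F N : Mink n) (ρ : ℝ) : Mink n :=
  (k * Real.sinh (k * ρ)) • F + Real.cosh (k * ρ) • N

theorem hasDerivAt_geodesic (hk : 0 < k) (F N : Mink n) (ρ : ℝ) :
    HasDerivAt (geodesic k F N) (geodesicVelocity k F N ρ) ρ := by
  have hl : HasDerivAt (fun ρ => k * ρ) k ρ := by simpa using (hasDerivAt_id ρ).const_mul k
  have h1 := (hl.cosh.smul_const F).add ((hl.sinh.const_mul (1 / k)).smul_const N)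
  refine h1.congr_deriv ?_
  rw [geodesicVelocity]
  congr 2
  · ring
  · field_simp

theorem lorentz_geodesic (hk : 0 < k) (hF : lorentz F F = -(1 / k ^ 2)) (hN : lorentz N N = 1)
    (hNF : lorentz N F = 0) (ρ : ℝ) :
    lorentz (geodesic k F N ρ) (geodesic k F N ρ) = -(1 / k ^ 2) ∧
    lorentz (geodesicVelocity k F N ρ) (geodesicVelocity k F N ρ) = 1 ∧
    lorentz (geodesic k F N ρ) (geodesicVelocity k F N ρ) = 0 := by
  have hcs := Real.cosh_sq (k * ρ)
  simp only [geodesic, geodesicVelocity, lorentz_add_left, lorentz_add_right, lorentz_smul_left,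
    lorentz_smul_right, hF, hN, hNF, lorentz_comm F N]
  refine ⟨?_, ?_, ?_⟩
  · field_simp; linear_combination -hcs
  · field_simp; linear_combination hcs
  · field_simp; ring

theorem radial_bounds {s₁ s₂ a b sh ch s : ℝ} (hs₁ : 0 < s₁) (hs₂ : 0 < s₂) (hb : s₁ ≤ b)
    (ha₁ : s₁ ^ 2 ≤ a ^ 2 - 1) (ha₂ : a ^ 2 - 1 ≤ s₂ ^ 2) (ha : 1 ≤ a) (hba : b ^ 2 ≤ a ^ 2 - 1)
    (hsh : 0 < sh) (hch : 1 ≤ ch) (hcs : ch ^ 2 = sh ^ 2 + 1) (hs : 0 < s)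
    (hs2 : s ^ 2 = (a * ch + b * sh) ^ 2 - 1) :
    0 < a * sh + b * ch ∧ s₁ / s₂ ≤ (a * sh + b * ch) / s ∧ s₁ ≤ s ∧
      (a * sh + b * ch) ^ 2 ≤ s ^ 2 := by
  have hb0 : 0 < b := hs₁.trans_le hb
  have hs2' : s ^ 2 = (a * sh + b * ch) ^ 2 + (a ^ 2 - 1) - b ^ 2 := by
    rw [hs2]; linear_combination (a ^ 2 - b ^ 2) * hcs
  have hcb : b ≤ a * sh + b * ch := by nlinarith
  generalize a * sh + b * ch = c at *
  have hua : a ≤ a * ch + b * sh := by nlinarith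
  have hb2 : s₁ ^ 2 ≤ b ^ 2 := by nlinarith
  have hcb2 : b ^ 2 ≤ c ^ 2 := by nlinarith
  refine ⟨hb0.trans_le hcb, ?_, ?_, by linarith⟩
  · rw [div_le_div_iff₀ hs₂ hs]
    refine (sq_le_sq₀ (by positivity) (mul_nonneg (hb0.le.trans hcb) hs₂.le)).1 ?_
    have h3 : (s₂ ^ 2 - s₁ ^ 2) * b ^ 2 ≤ (s₂ ^ 2 - s₁ ^ 2) * c ^ 2 :=
      mul_le_mul_of_nonneg_left hcb2 (by linarith)
    have h4 : s₁ ^ 2 * (a ^ 2 - 1) ≤ b ^ 2 * s₂ ^ 2 :=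
      mul_le_mul hb2 ha₂ (by nlinarith) (sq_nonneg b)
    rw [mul_pow, mul_pow, hs2']
    nlinarith
  · refine (sq_le_sq₀ hs₁.le hs.le).1 ?_
    rw [hs2]
    nlinarith

theorem polar_estimates (hk : 0 < k) (hF : F ∈ Hyp n k) (hN : lorentz N N = 1)
    (hNF : lorentz N F = 0) {R₁ R₂ : ℝ} (hR₁ : 0 < R₁) (hR₂ : 0 < R₂)
    (hN2 : Real.sinh (k * R₁) ≤ N.2) (hF₁ : Real.cosh (k * R₁) ≤ k * F.2)
    (hF₂ : k * F.2 ≤ Real.cosh (k * R₂)) {y : EuclideanSpace ℝ (Fin n)} (hy : ‖y‖ = 1)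
    {r φ : ℝ → ℝ} (hr : r = fun ρ => radius k (geodesic k F N ρ))
    (hφ : φ = fun ρ => ∑ i, angular (geodesic k F N ρ) i * y i) {ρ : ℝ} (hρ : 0 < ρ) :
    0 < r ρ ∧ DifferentiableAt ℝ r ρ ∧ DifferentiableAt ℝ φ ρ ∧
    (deriv φ ρ) ^ 2 ≤
      (1 - φ ρ ^ 2) * k ^ 2 * Real.sinh (k * r ρ) ^ (-2 : ℤ) * (1 - (deriv r ρ) ^ 2) ∧
    Real.sinh (k * R₁) / Real.sinh (k * R₂) ≤ deriv r ρ ∧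
    |deriv φ ρ| ≤
      (1 / Real.sinh (k * R₁) *
        (Real.sinh (k * R₂) ^ 2 / Real.sinh (k * R₁) ^ 2 - 1) ^ (1 / 2 : ℝ)) *
        k * deriv r ρ := by
  obtain ⟨hXX, hVV, hXV⟩ := lorentz_geodesic hk hF.1 hN hNF ρ
  have hder := hasDerivAt_geodesic hk F N ρ
  have hs₁0 : 0 < Real.sinh (k * R₁) := Real.sinh_pos_iff.2 (by positivity)
  have hs₂0 : 0 < Real.sinh (k * R₂) := Real.sinh_pos_iff.2 (by positivity)
  have hF₁' : Real.sinh (k * R₁) ^ 2 ≤ (k * F.2) ^ 2 - 1 := by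
    nlinarith [Real.cosh_sq (k * R₁), Real.one_le_cosh (k * R₁)]
  have hF₂' : (k * F.2) ^ 2 - 1 ≤ Real.sinh (k * R₂) ^ 2 := by
    nlinarith [Real.cosh_sq (k * R₂), Hyp.one_le hk hF]
  have hb0 : 0 < N.2 := hs₁0.trans_le hN2
  have ha1 : 1 ≤ k * F.2 := Hyp.one_le hk hF
  have hsh0 : 0 < Real.sinh (k * ρ) := Real.sinh_pos_iff.2 (by positivity)
  have hch1 : 1 ≤ Real.cosh (k * ρ) := Real.one_le_cosh _
  have hX2 : k * (geodesic k F N ρ).2 =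
      k * F.2 * Real.cosh (k * ρ) + N.2 * Real.sinh (k * ρ) := by
    simp only [geodesic, Prod.snd_add, Prod.smul_snd, smul_eq_mul]
    field_simp
  have hV2 : (geodesicVelocity k F N ρ).2 =
      k * F.2 * Real.sinh (k * ρ) + N.2 * Real.cosh (k * ρ) := by
    simp only [geodesicVelocity, Prod.snd_add, Prod.smul_snd, smul_eq_mul]
    ring
  have hu1 : 1 < k * (geodesic k F N ρ).2 := by rw [hX2]; nlinarith
  have hXH : geodesic k F N ρ ∈ Hyp n k :=
    ⟨hXX, pos_of_mul_pos_right (one_pos.trans hu1) hk.le⟩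
  have hspos := sinh_mul_radius_pos hk hu1
  have hrpos : 0 < r ρ := by
    rw [hr]
    exact pos_of_mul_pos_right (Real.sinh_pos_iff.1 hspos) hk.le
  have hr' := hasDerivAt_radius hk hder hu1
  obtain ⟨D, hφ', hang, hφ1⟩ := hasDerivAt_angular hk hder hXH hu1 hVV hXV hy
  rw [← hr] at hr'
  rw [← hφ] at hφ'
  have hBA : N.2 ^ 2 ≤ (k * F.2) ^ 2 - 1 := by
    have h1 := real_inner_mul_inner_self_le N.1 F.1
    have hF1 := Hyp.norm_sq hk hF
    rw [lorentz_self] at hN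
    rw [lorentz] at hNF
    simp only [real_inner_self_eq_norm_sq] at h1
    have e1 : inner ℝ N.1 F.1 = N.2 * F.2 := by linarith
    have e2 : ‖N.1‖ ^ 2 = 1 + N.2 ^ 2 := by linarith
    rw [e1, e2] at h1
    have h2 := mul_le_mul_of_nonneg_left h1 (sq_nonneg k)
    have e3 : k ^ 2 * ((1 + N.2 ^ 2) * ‖F.1‖ ^ 2) = (1 + N.2 ^ 2) * ((k * F.2) ^ 2 - 1) := by
      rw [← hF1]; ring
    rw [e3] at h2
    linarith
  have hs2 : Real.sinh (k * radius k (geodesic k F N ρ)) ^ 2 =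
      (k * (geodesic k F N ρ).2) ^ 2 - 1 := by
    rw [sinh_mul_radius hk hXH, Hyp.norm_sq hk hXH]
  have key := radial_bounds hs₁0 hs₂0 hN2 hF₁' hF₂' ha1 hBA hsh0 hch1 (Real.cosh_sq (k * ρ)) hspos
    (by rw [hs2, hX2])
  rw [← hV2] at key
  obtain ⟨hc0, hratio, hs1s, hcs⟩ := key
  have hrρ : r ρ = radius k (geodesic k F N ρ) := by rw [hr]
  have hφρ : φ ρ = ∑ i, angular (geodesic k F N ρ) i * y i := by rw [hφ]
  rw [← hrρ] at hr' hang hratio hs1s hcs hspos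
  rw [← hφρ] at hang hφ1
  rw [hφ'.deriv, hr'.deriv]
  refine ⟨hrpos, hr'.differentiableAt, hφ'.differentiableAt, ?_, hratio, ?_⟩
  · rw [zpow_neg]
    refine hang.trans_eq ?_
    norm_cast
    ring
  · rw [← Real.sqrt_eq_rpow]
    generalize Real.sinh (k * r ρ) = s at *
    generalize Real.sinh (k * R₁) = s₁ at *
    generalize Real.sinh (k * R₂) = s₂ at *
    generalize (geodesicVelocity k F N ρ).2 = c at *
    have h3 : 1 ≤ s₂ ^ 2 / s₁ ^ 2 * (c / s) ^ 2 := by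
      have h4 := pow_le_pow_left₀ (by positivity) hratio 2
      rw [div_pow, div_le_iff₀ (by positivity)] at h4
      rw [div_mul_eq_mul_div, le_div_iff₀ (by positivity)]
      linarith
    have h1 : 0 ≤ 1 - (c / s) ^ 2 := by
      rw [div_pow, sub_nonneg, div_le_one (by positivity)]; exact hcs
    have hq : 0 ≤ s₂ ^ 2 / s₁ ^ 2 - 1 := by
      have h4 : s₂ ^ 2 / s₁ ^ 2 * (c / s) ^ 2 ≤ s₂ ^ 2 / s₁ ^ 2 :=
        mul_le_of_le_one_right (by positivity) (by linarith)
      linarith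
    refine abs_le_of_sq_le_sq ?_ (by positivity)
    calc D ^ 2 ≤ (1 - φ ρ ^ 2) * (k ^ 2 * (1 - (c / s) ^ 2) / s ^ 2) := hang
      _ ≤ k ^ 2 * (1 - (c / s) ^ 2) / s ^ 2 :=
        mul_le_of_le_one_left (by positivity) (by linarith [sq_nonneg (φ ρ)])
      _ ≤ k ^ 2 * (1 - (c / s) ^ 2) / s₁ ^ 2 := by gcongr
      _ ≤ k ^ 2 * ((s₂ ^ 2 / s₁ ^ 2 - 1) * (c / s) ^ 2) / s₁ ^ 2 := by
        gcongr
        linarith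
      _ = _ := by
        simp only [mul_pow, Real.sq_sqrt hq]
        ring

end Polar

end HypFoliation

end

noncomputable section

namespace HypFoliation

/-! ### The Gauss equation -/

section Gauss

variable {d n : ℕ}

local notation "𝔼" => EuclideanSpace ℝ (Fin d)

theorem contDiffAt_pd {G : Type*} [NormedAddCommGroup G] [NormedSpace ℝ G] {f : 𝔼 → G} {x : 𝔼}
    (hf : ContDiffAt ℝ ∞ f x) (i : Fin d) : ContDiffAt ℝ ∞ (pd i f) x :=
  (hf.fderiv_right (m := ∞) (by simp)).clm_apply contDiffAt_const

theorem pd_congr {G : Type*} [NormedAddCommGroup G] [NormedSpace ℝ G] {f f' : 𝔼 → G} {x : 𝔼}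
    (h : f =ᶠ[𝓝 x] f') (i : Fin d) : pd i f x = pd i f' x := by
  rw [pd, h.fderiv_eq, pd]

theorem pd_pd_eq {G : Type*} [NormedAddCommGroup G] [NormedSpace ℝ G] {f : 𝔼 → G} {x : 𝔼}
    (hf : ContDiffAt ℝ ∞ f x) (i j : Fin d) :
    pd i (pd j f) x =
      fderiv ℝ (fderiv ℝ f) x (EuclideanSpace.single i 1) (EuclideanSpace.single j 1) := by
  have h := (hf.fderiv_right (m := ∞) (by simp)).differentiableAt (by simp)
  have h2 := h.hasFDerivAt.clm_apply (hasFDerivAt_const (EuclideanSpace.single j (1 : ℝ)) x)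
  have h3 : HasFDerivAt (pd j f) _ x := h2
  rw [pd, h3.fderiv]
  simp

theorem fderiv_fderiv_symm {G : Type*} [NormedAddCommGroup G] [NormedSpace ℝ G] {f : 𝔼 → G}
    {x : 𝔼} (hf : ContDiffAt ℝ ∞ f x) (u w : 𝔼) :
    fderiv ℝ (fderiv ℝ f) x u w = fderiv ℝ (fderiv ℝ f) x w u :=
  (hf.isSymmSndFDerivAt (by
    rw [minSmoothness_of_isRCLikeNormedField]; exact WithTop.coe_le_coe.2 (le_top (a := (2 : ℕ∞))))).eq u w

theorem pd_comm {G : Type*} [NormedAddCommGroup G] [NormedSpace ℝ G] {f : 𝔼 → G} {x : 𝔼}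
    (hf : ContDiffAt ℝ ∞ f x) (i j : Fin d) : pd i (pd j f) x = pd j (pd i f) x := by
  rw [pd_pd_eq hf, pd_pd_eq hf, fderiv_fderiv_symm hf]

theorem pd_lorentz {u w : 𝔼 → Mink n} {x : 𝔼} (hu : DifferentiableAt ℝ u x)
    (hw : DifferentiableAt ℝ w x) (i : Fin d) :
    pd i (fun z => lorentz (u z) (w z)) x = lorentz (pd i u x) (w x) + lorentz (u x) (pd i w x) :=
  fderiv_lorentz_apply hu.hasFDerivAt hw.hasFDerivAt _

theorem sum_smul_pd {G : Type*} [NormedAddCommGroup G] [NormedSpace ℝ G] (f : 𝔼 → G) (x u : 𝔼) :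
    ∑ i, u i • pd i f x = fderiv ℝ f x u := by
  conv_rhs => rw [← (EuclideanSpace.basisFun (Fin d) ℝ).sum_repr u]
  simp [map_sum, pd]

theorem contDiffAt_lorentz {u w : 𝔼 → Mink n} {x : 𝔼} {m : WithTop ℕ∞} (hu : ContDiffAt ℝ m u x)
    (hw : ContDiffAt ℝ m w x) : ContDiffAt ℝ m (fun z => lorentz (u z) (w z)) x :=
  contDiff_lorentz.contDiffAt.comp x (hu.prodMk hw)

theorem contDiffAt_det {ι : Type*} [Fintype ι] [DecidableEq ι] {M : 𝔼 → Matrix ι ι ℝ} {x : 𝔼}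
    (h : ∀ i j, ContDiffAt ℝ ∞ (fun z => M z i j) x) : ContDiffAt ℝ ∞ (fun z => (M z).det) x := by
  simp only [Matrix.det_apply]
  exact ContDiffAt.sum fun σ _ => (contDiffAt_prod fun i _ => h _ _).const_smul _

theorem contDiffAt_matrix_inv {ι : Type*} [Fintype ι] [DecidableEq ι] {M : 𝔼 → Matrix ι ι ℝ}
    {x : 𝔼} (h : ∀ i j, ContDiffAt ℝ ∞ (fun z => M z i j) x) (hdet : (M x).det ≠ 0) (i j : ι) :
    ContDiffAt ℝ ∞ (fun z => (M z)⁻¹ i j) x := by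
  simp only [Matrix.inv_def, Ring.inverse_eq_inv', Matrix.smul_apply, smul_eq_mul,
    Matrix.adjugate_apply]
  refine ((contDiffAt_det h).inv hdet).mul (contDiffAt_det fun a b => ?_)
  rcases eq_or_ne a j with rfl | hne
  · simpa using contDiffAt_const
  · simpa [Matrix.updateRow_ne hne] using h a b

/-- The first fundamental form of a parametrized surface in Minkowski space. -/
def gram (f : 𝔼 → Mink n) (x : 𝔼) : Matrix (Fin d) (Fin d) ℝ :=
  Matrix.of fun i j => lorentz (pd i f x) (pd j f x)

theorem gram_apply (f : 𝔼 → Mink n) (x : 𝔼) (i j : Fin d) :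
    gram f x i j = lorentz (pd i f x) (pd j f x) := rfl

variable {f : EuclideanSpace ℝ (Fin d) → Mink n} {x x₀ : EuclideanSpace ℝ (Fin d)}

theorem contDiffAt_gram (hf : ContDiffAt ℝ ∞ f x) (i j : Fin d) :
    ContDiffAt ℝ ∞ (fun z => gram f z i j) x :=
  contDiffAt_lorentz (contDiffAt_pd hf i) (contDiffAt_pd hf j)

theorem christoffel_gram (hf : ContDiffAt ℝ ∞ f x) (l i j : Fin d) :
    christoffel (gram f) l i j x =
      ∑ m, (gram f x)⁻¹ l m * lorentz (pd i (pd j f) x) (pd m f x) := by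
  have hd := fun i => (contDiffAt_pd hf i).differentiableAt (by simp)
  rw [christoffel, Finset.mul_sum]
  refine Finset.sum_congr rfl fun m _ => ?_
  simp only [gram_apply, pd_lorentz (hd _) (hd _), pd_comm hf j i, pd_comm hf m i, pd_comm hf m j,
    lorentz_comm _ (pd i (pd m f) x), lorentz_comm _ (pd j (pd m f) x)]
  ring

theorem sum_christoffel_mul_gram (hf : ContDiffAt ℝ ∞ f x) (hdet : (gram f x).det ≠ 0)
    (i j m : Fin d) :
    ∑ l, christoffel (gram f) l i j x * gram f x l m = lorentz (pd i (pd j f) x) (pd m f x) := by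
  simp only [christoffel_gram hf, Finset.sum_mul]
  rw [Finset.sum_comm]
  have h : ∀ s, ∑ l, gram f x m l * (gram f x)⁻¹ l s = (1 : Matrix (Fin d) (Fin d) ℝ) m s := by
    intro s
    rw [← Matrix.mul_apply, Matrix.mul_nonsing_inv _ (isUnit_iff_ne_zero.2 hdet)]
  calc _ = ∑ s, lorentz (pd i (pd j f) x) (pd s f x) *
        ∑ l, gram f x m l * (gram f x)⁻¹ l s := by
        refine Finset.sum_congr rfl fun s _ => ?_
        rw [Finset.mul_sum]
        refine Finset.sum_congr rfl fun l _ => ?_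
        rw [gram_apply f x l m, gram_apply f x m l, lorentz_comm (pd l f x)]
        ring
    _ = _ := by simp [h, Matrix.one_apply]

theorem contDiffAt_christoffel (hf : ∀ᶠ z in 𝓝 x, ContDiffAt ℝ ∞ f z)
    (hdet : (gram f x).det ≠ 0) (l i j : Fin d) :
    ContDiffAt ℝ ∞ (christoffel (gram f) l i j) x := by
  have h0 := hf.self_of_nhds
  have h1 : christoffel (gram f) l i j =ᶠ[𝓝 x]
      fun z => ∑ m, (gram f z)⁻¹ l m * lorentz (pd i (pd j f) z) (pd m f z) :=
    hf.mono fun z hz => christoffel_gram hz l i j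
  refine ContDiffAt.congr_of_eventuallyEq ?_ h1
  exact ContDiffAt.sum fun m _ => (contDiffAt_matrix_inv (contDiffAt_gram h0) hdet l m).mul
    (contDiffAt_lorentz (contDiffAt_pd (contDiffAt_pd h0 j) i) (contDiffAt_pd h0 m))

/-- The part of `∂ᵢ∂ⱼ f` that is normal to the surface. -/
def normalPart (f : 𝔼 → Mink n) (i j : Fin d) (x : 𝔼) : Mink n :=
  pd i (pd j f) x - ∑ l, christoffel (gram f) l i j x • pd l f x

theorem lorentz_normalPart_pd (hf : ContDiffAt ℝ ∞ f x) (hdet : (gram f x).det ≠ 0)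
    (i j m : Fin d) : lorentz (normalPart f i j x) (pd m f x) = 0 := by
  rw [normalPart, lorentz_sub_left, lorentz_sum_left]
  simp only [lorentz_smul_left, ← gram_apply]
  rw [sum_christoffel_mul_gram hf hdet, sub_self]

theorem eventually_det_ne (hf : ContDiffAt ℝ ∞ f x) (hdet : (gram f x).det ≠ 0) :
    ∀ᶠ z in 𝓝 x, (gram f z).det ≠ 0 :=
  (contDiffAt_det (contDiffAt_gram hf)).continuousAt.eventually_ne hdet

theorem pd_normalPart (hf : ∀ᶠ z in 𝓝 x, ContDiffAt ℝ ∞ f z) (hdet : (gram f x).det ≠ 0)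
    (i j k : Fin d) :
    pd i (normalPart f j k) x = pd i (pd j (pd k f)) x -
      ∑ l, (christoffel (gram f) l j k x • pd i (pd l f) x +
        pd i (christoffel (gram f) l j k) x • pd l f x) := by
  have h0 := hf.self_of_nhds
  have h1 := (contDiffAt_pd (contDiffAt_pd h0 k) j).differentiableAt (by simp)
  have h2 := fun l => (contDiffAt_christoffel hf hdet l j k).differentiableAt (by simp)
  have h3 := fun l => (contDiffAt_pd h0 l).differentiableAt (by simp)
  have h4 : HasFDerivAt (normalPart f j k) _ x := h1.hasFDerivAt.sub
    (HasFDerivAt.fun_sum fun l (_ : l ∈ Finset.univ) => (h2 l).hasFDerivAt.smul (h3 l).hasFDerivAt)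
  rw [pd, h4.fderiv]
  simp [pd, sum_apply]

theorem differentiableAt_normalPart (hf : ∀ᶠ z in 𝓝 x, ContDiffAt ℝ ∞ f z)
    (hdet : (gram f x).det ≠ 0) (j k : Fin d) : DifferentiableAt ℝ (normalPart f j k) x := by
  have h0 := hf.self_of_nhds
  have h1 : ContDiffAt ℝ ∞ (normalPart f j k) x :=
    (contDiffAt_pd (contDiffAt_pd h0 k) j).sub
      (ContDiffAt.sum fun l _ => (contDiffAt_christoffel hf hdet l j k).smul (contDiffAt_pd h0 l))
  exact h1.differentiableAt (by simp)

theorem sum_gram_mul_pd_christoffel (hf : ∀ᶠ z in 𝓝 x, ContDiffAt ℝ ∞ f z)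
    (hdet : (gram f x).det ≠ 0) (i j k m : Fin d) :
    ∑ l, gram f x l m * (pd i (christoffel (gram f) l j k) x +
      ∑ s, christoffel (gram f) s j k x * christoffel (gram f) l i s x) =
    lorentz (pd i (pd j (pd k f)) x) (pd m f x) +
      lorentz (normalPart f j k x) (normalPart f i m x) := by
  have h0 := hf.self_of_nhds
  have hzero : pd i (fun z => lorentz (normalPart f j k z) (pd m f z)) x = 0 := by
    have : (fun z => lorentz (normalPart f j k z) (pd m f z)) =ᶠ[𝓝 x] fun _ => 0 := by
      filter_upwards [hf, eventually_det_ne h0 hdet] with z hz hz'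
      exact lorentz_normalPart_pd hz hz' j k m
    rw [pd_congr this, pd]
    simp
  rw [pd_lorentz (differentiableAt_normalPart hf hdet j k)
    ((contDiffAt_pd h0 m).differentiableAt (by simp)), pd_normalPart hf hdet] at hzero
  have hN : lorentz (normalPart f j k x) (pd i (pd m f) x) =
      lorentz (normalPart f j k x) (normalPart f i m x) := by
    conv_rhs => rw [normalPart.eq_1 f i m x]
    rw [lorentz_sub_right, lorentz_sum_right]
    simp only [lorentz_smul_right, lorentz_normalPart_pd h0 hdet]
    simp
  rw [hN, lorentz_sub_left, lorentz_sum_left] at hzero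
  simp only [lorentz_add_left, lorentz_smul_left, ← gram_apply,
    ← sum_christoffel_mul_gram h0 hdet] at hzero
  rw [Finset.sum_add_distrib] at hzero
  have e1 : ∑ l, gram f x l m * (pd i (christoffel (gram f) l j k) x +
      ∑ s, christoffel (gram f) s j k x * christoffel (gram f) l i s x) =
      ∑ l, pd i (christoffel (gram f) l j k) x * gram f x l m +
      ∑ s, christoffel (gram f) s j k x * ∑ l, christoffel (gram f) l i s x * gram f x l m := by
    simp only [mul_add, Finset.sum_add_distrib, Finset.mul_sum]
    congr 1
    · exact Finset.sum_congr rfl fun l _ => mul_comm _ _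
    · rw [Finset.sum_comm]
      exact Finset.sum_congr rfl fun s _ => Finset.sum_congr rfl fun l _ => by ring
  rw [e1]
  linarith

/-- The **Gauss equation** for a surface in Minkowski space. -/
theorem gauss_equation (hf : ∀ᶠ z in 𝓝 x, ContDiffAt ℝ ∞ f z) (hdet : (gram f x).det ≠ 0)
    (i j k m : Fin d) :
    ∑ l, gram f x l m * riemann (gram f) l i j k x =
      lorentz (normalPart f j k x) (normalPart f i m x) -
        lorentz (normalPart f i k x) (normalPart f j m x) := by
  have h1 := sum_gram_mul_pd_christoffel hf hdet i j k m
  have h2 := sum_gram_mul_pd_christoffel hf hdet j i k m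
  rw [pd_comm (contDiffAt_pd hf.self_of_nhds k) j i] at h2
  have h3 : ∑ l, gram f x l m * riemann (gram f) l i j k x =
      ∑ l, gram f x l m * (pd i (christoffel (gram f) l j k) x +
        ∑ s, christoffel (gram f) s j k x * christoffel (gram f) l i s x) -
      ∑ l, gram f x l m * (pd j (christoffel (gram f) l i k) x +
        ∑ s, christoffel (gram f) s i k x * christoffel (gram f) l j s x) := by
    rw [← Finset.sum_sub_distrib]
    refine Finset.sum_congr rfl fun l _ => ?_
    rw [riemann, Finset.sum_sub_distrib]
    ring
  rw [h3, h1, h2]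
  ring

theorem contract_mul (A B : Matrix (Fin d) (Fin d) ℝ) (v w : Fin d → ℝ) :
    (∑ i, ∑ j, ∑ k, ∑ m, v i * w j * w k * v m * (A j k * B i m) =
      (∑ i, ∑ j, A i j * w i * w j) * ∑ i, ∑ j, B i j * v i * v j) ∧
    ∑ i, ∑ j, ∑ k, ∑ m, v i * w j * w k * v m * (A i k * B j m) =
      (∑ i, ∑ j, A i j * v i * w j) * ∑ i, ∑ j, B i j * w i * v j := by
  have h : ∀ a b c e : Fin d → ℝ,
      (∑ i, ∑ j, A i j * a i * b j) * ∑ i, ∑ j, B i j * c i * e j =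
        ∑ i, ∑ j, ∑ k, ∑ m, A i k * a i * b k * (B j m * c j * e m) := by
    intro a b c e
    simp only [Finset.sum_mul_sum]
  constructor
  · rw [h, Finset.sum_comm]
    exact Finset.sum_congr rfl fun i _ => Finset.sum_congr rfl fun j _ =>
      Finset.sum_congr rfl fun k _ => Finset.sum_congr rfl fun m _ => by ring
  · rw [h]
    exact Finset.sum_congr rfl fun i _ => Finset.sum_congr rfl fun j _ =>
      Finset.sum_congr rfl fun k _ => Finset.sum_congr rfl fun m _ => by ring

/-- The second fundamental form with respect to `N`, up to sign. -/
def secondForm (f : 𝔼 → Mink n) (N : Mink n) (x : 𝔼) : Matrix (Fin d) (Fin d) ℝ :=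
  Matrix.of fun i j => lorentz (pd i (pd j f) x) N

theorem sum_gram (f : 𝔼 → Mink n) (x u w : 𝔼) :
    ∑ i, ∑ j, gram f x i j * u i * w j = lorentz (fderiv ℝ f x u) (fderiv ℝ f x w) := by
  rw [← sum_smul_pd, ← sum_smul_pd, lorentz_sum_left]
  refine Finset.sum_congr rfl fun i _ => ?_
  rw [lorentz_sum_right]
  refine Finset.sum_congr rfl fun j _ => ?_
  rw [lorentz_smul_left, lorentz_smul_right, gram_apply]
  ring

theorem sum_secondForm (hf : ContDiffAt ℝ ∞ f x) (N : Mink n) (u w : 𝔼) :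
    ∑ i, ∑ j, secondForm f N x i j * u i * w j =
      lorentz (fderiv ℝ (fderiv ℝ f) x u w) N := by
  have h : fderiv ℝ (fderiv ℝ f) x u w = ∑ i, ∑ j, (u i * w j) • pd i (pd j f) x := by
    simp only [pd_pd_eq hf]
    conv_lhs => rw [← (EuclideanSpace.basisFun (Fin d) ℝ).sum_repr u,
      ← (EuclideanSpace.basisFun (Fin d) ℝ).sum_repr w]
    simp only [map_sum, map_smul, sum_apply, smul_apply,
      EuclideanSpace.basisFun_apply, EuclideanSpace.basisFun_repr, Finset.smul_sum, smul_smul]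
    rw [Finset.sum_comm]
    exact Finset.sum_congr rfl fun i _ => Finset.sum_congr rfl fun j _ => by rw [mul_comm]
  rw [h]
  simp only [lorentz_sum_left, lorentz_smul_left, secondForm, Matrix.of_apply]
  exact Finset.sum_congr rfl fun i _ => Finset.sum_congr rfl fun j _ => by ring

/-- Data of a unit normal vector at a point of an immersed hypersurface of hyperbolic space. -/
structure IsNormalAt (f : 𝔼 → Mink n) (k : ℝ) (N : Mink n) (x : 𝔼) : Prop where
  contDiff : ∀ᶠ z in 𝓝 x, ContDiffAt ℝ ∞ f z
  mem_hyp : ∀ᶠ z in 𝓝 x, f z ∈ Hyp n k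
  injective : Function.Injective (fderiv ℝ f x)
  normal_self : lorentz N N = 1
  normal_pos : lorentz N (f x) = 0
  normal_tangent : ∀ u, lorentz N (fderiv ℝ f x u) = 0

theorem lorentz_fderiv_eq_zero {k : ℝ} (hf : DifferentiableAt ℝ f x)
    (hm : ∀ᶠ z in 𝓝 x, f z ∈ Hyp n k) (u : 𝔼) : lorentz (f x) (fderiv ℝ f x u) = 0 := by
  have h1 := fderiv_lorentz_apply hf.hasFDerivAt hf.hasFDerivAt u
  have h2 : (fun z => lorentz (f z) (f z)) =ᶠ[𝓝 x] fun _ => -(1 / k ^ 2) := hm.mono fun z hz => hz.1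
  rw [h2.fderiv_eq, lorentz_comm (fderiv ℝ f x u)] at h1
  simp at h1
  linarith

namespace IsNormalAt

variable {k : ℝ} {N : Mink n}

theorem tangent (h : IsNormalAt f k N x) (u : 𝔼) : lorentz (f x) (fderiv ℝ f x u) = 0 :=
  lorentz_fderiv_eq_zero (h.contDiff.self_of_nhds.differentiableAt (by simp)) h.mem_hyp u

theorem timelike (h : IsNormalAt f k N x) (hk : 0 < k) : lorentz (f x) (f x) < 0 := by
  rw [h.mem_hyp.self_of_nhds.1]
  have : 0 < 1 / k ^ 2 := by positivity
  linarith

theorem gram_pos (h : IsNormalAt f k N x) (hk : 0 < k) {u : 𝔼} (hu : u ≠ 0) :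
    0 < lorentz (fderiv ℝ f x u) (fderiv ℝ f x u) :=
  lorentz_self_pos (h.timelike hk) (h.tangent u)
    fun h0 => hu (h.injective (by rw [h0, map_zero]))

theorem det_ne_zero (h : IsNormalAt f k N x) (hk : 0 < k) : (gram f x).det ≠ 0 := by
  intro h0
  obtain ⟨v, hv, hv0⟩ := Matrix.exists_mulVec_eq_zero_iff.2 h0
  have h1 := h.gram_pos hk (u := WithLp.toLp 2 v) (by simpa using hv)
  rw [← sum_gram] at h1
  have h2 : ∑ i, ∑ j, gram f x i j * v i * v j = ∑ i, v i * (gram f x).mulVec v i := by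
    refine Finset.sum_congr rfl fun i _ => ?_
    rw [Matrix.mulVec, dotProduct, Finset.mul_sum]
    exact Finset.sum_congr rfl fun j _ => by ring
  rw [h2, hv0] at h1
  simp at h1

theorem eq_zero (h : IsNormalAt f k N x) (hk : 0 < k) (hd : d + 1 = n) {Z : Mink n}
    (h1 : lorentz Z (f x) = 0) (h2 : lorentz Z N = 0)
    (h3 : ∀ u, lorentz Z (fderiv ℝ f x u) = 0) : Z = 0 :=
  eq_zero_of_orthogonal_frame (by rw [finrank_euclideanSpace, Fintype.card_fin, hd])
    (fderiv ℝ f x).toLinearMap h.injective (h.timelike hk) h.normal_self h.normal_pos h.tangent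
    h.normal_tangent h1 h2 h3

theorem lorentz_pd_pd_self (h : IsNormalAt f k N x) (i j : Fin d) :
    lorentz (pd i (pd j f) x) (f x) = -gram f x i j := by
  have hc := h.contDiff.self_of_nhds
  have h1 : pd i (fun z => lorentz (pd j f z) (f z)) x = 0 := by
    have : (fun z => lorentz (pd j f z) (f z)) =ᶠ[𝓝 x] fun _ => 0 := by
      filter_upwards [h.contDiff, h.mem_hyp.eventually_nhds] with z hz hz'
      rw [lorentz_comm]
      exact lorentz_fderiv_eq_zero (hz.differentiableAt (by simp)) hz' _
    rw [pd_congr this, pd]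
    simp
  rw [pd_lorentz ((contDiffAt_pd hc j).differentiableAt (by simp))
    (hc.differentiableAt (by simp))] at h1
  rw [gram_apply, lorentz_comm (pd i f x)]
  linarith

theorem normalPart_eq (h : IsNormalAt f k N x) (hk : 0 < k) (hd : d + 1 = n) (i j : Fin d) :
    normalPart f i j x = (k ^ 2 * gram f x i j) • f x + secondForm f N x i j • N := by
  rw [← sub_eq_zero]
  have hpd : ∀ l, lorentz (pd l f x) (f x) = 0 := fun l => by
    rw [lorentz_comm]; exact h.tangent _
  have hpdN : ∀ l, lorentz (pd l f x) N = 0 := fun l => by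
    rw [lorentz_comm]; exact h.normal_tangent _
  refine h.eq_zero hk hd ?_ ?_ fun u => ?_
  · rw [normalPart]
    simp only [lorentz_sub_left, lorentz_add_left, lorentz_smul_left, lorentz_sum_left, hpd,
      h.normal_pos, h.mem_hyp.self_of_nhds.1, h.lorentz_pd_pd_self]
    field_simp
    simp
  · rw [normalPart]
    simp only [lorentz_sub_left, lorentz_add_left, lorentz_smul_left, lorentz_sum_left, hpdN,
      h.normal_self, lorentz_comm (f x) N, h.normal_pos, secondForm, Matrix.of_apply]
    simp
  · rw [← sum_smul_pd, lorentz_sum_right]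
    refine Finset.sum_eq_zero fun m _ => ?_
    have h1 := lorentz_normalPart_pd h.contDiff.self_of_nhds (h.det_ne_zero hk) i j m
    simp only [lorentz_sub_left, lorentz_add_left, lorentz_smul_left, lorentz_smul_right, h1,
      lorentz_comm (f x), hpd, lorentz_comm N, hpdN]
    simp

/-- For a hypersurface whose sectional curvatures exceed those of the ambient space, the second
fundamental form restricted to a plane has a positive determinant. -/
theorem secondForm_det_pos (h : IsNormalAt f k N x) (hk : 0 < k) (hd : d + 1 = n) {u w : 𝔼}
    (hli : LinearIndependent ℝ ![u, w]) (hsec : -k ^ 2 < sectional (gram f) x u w) :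
    lorentz (fderiv ℝ (fderiv ℝ f) x u w) N ^ 2 <
      lorentz (fderiv ℝ (fderiv ℝ f) x u u) N * lorentz (fderiv ℝ (fderiv ℝ f) x w w) N := by
  have hc := h.contDiff.self_of_nhds
  have hdet := h.det_ne_zero hk
  have hnum : ∑ i, ∑ j, ∑ a, ∑ l, ∑ m,
      u i * w j * w a * u m * (gram f x l m * riemann (gram f) l i j a x) =
      -k ^ 2 * ((∑ i, ∑ j, gram f x i j * w i * w j) * (∑ i, ∑ j, gram f x i j * u i * u j) -
        (∑ i, ∑ j, gram f x i j * u i * w j) * (∑ i, ∑ j, gram f x i j * w i * u j)) +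
      ((∑ i, ∑ j, secondForm f N x i j * w i * w j) *
        (∑ i, ∑ j, secondForm f N x i j * u i * u j) -
        (∑ i, ∑ j, secondForm f N x i j * u i * w j) *
        (∑ i, ∑ j, secondForm f N x i j * w i * u j)) := by
    rw [← (contract_mul _ _ _ _).1, ← (contract_mul _ _ _ _).1, ← (contract_mul _ _ _ _).2,
      ← (contract_mul _ _ _ _).2]
    simp only [← Finset.sum_sub_distrib, Finset.mul_sum, ← Finset.sum_add_distrib]
    refine Finset.sum_congr rfl fun i _ => Finset.sum_congr rfl fun j _ =>
      Finset.sum_congr rfl fun a _ => ?_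
    rw [Finset.sum_comm]
    refine Finset.sum_congr rfl fun m _ => ?_
    rw [← Finset.mul_sum, gauss_equation h.contDiff hdet]
    simp only [h.normalPart_eq hk hd, lorentz_add_left, lorentz_add_right, lorentz_smul_left,
      lorentz_smul_right, h.normal_self, h.normal_pos, lorentz_comm (f x) N,
      h.mem_hyp.self_of_nhds.1]
    field_simp
    ring
  rw [sectional, hnum] at hsec
  simp only [sum_gram, sum_secondForm hc, fderiv_fderiv_symm hc w u, lorentz_comm (fderiv ℝ f x w) (fderiv ℝ f x u)]
    at hsec
  set guu := lorentz (fderiv ℝ f x u) (fderiv ℝ f x u) with hguu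
  set gww := lorentz (fderiv ℝ f x w) (fderiv ℝ f x w) with hgww
  set guw := lorentz (fderiv ℝ f x u) (fderiv ℝ f x w) with hguw
  have hpair := LinearIndependent.pair_iff.1 hli
  have hu0 : u ≠ 0 := fun h0 => by
    have := (hpair 1 0 (by simp [h0])).1
    exact one_ne_zero this
  have hguu0 : 0 < guu := h.gram_pos hk hu0
  have hz : guu • w - guw • u ≠ 0 := fun h0 => by
    have := (hpair (-guw) guu (by rw [← h0, neg_smul]; abel)).2
    exact hguu0.ne' this
  have hz2 := h.gram_pos hk hz
  have hden : 0 < guu * gww - guw ^ 2 := by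
    have e : lorentz (fderiv ℝ f x (guu • w - guw • u)) (fderiv ℝ f x (guu • w - guw • u)) =
        guu * (guu * gww - guw ^ 2) := by
      simp only [map_sub, map_smul, lorentz_sub_left, lorentz_sub_right, lorentz_smul_left,
        lorentz_smul_right, lorentz_comm (fderiv ℝ f x w) (fderiv ℝ f x u), ← hguu, ← hgww,
        ← hguw]
      ring
    rw [e] at hz2
    exact pos_of_mul_pos_right hz2 hguu0.le
  rw [lt_div_iff₀ hden] at hsec
  nlinarith

end IsNormalAt

end Gauss

end HypFoliation

end

noncomputable section

namespace HypFoliation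

/-! ### Local strict convexity -/

section LocalConvexity

variable {d n : ℕ} {f : EuclideanSpace ℝ (Fin d) → Mink n} {x : EuclideanSpace ℝ (Fin d)}
  {k : ℝ} {N : Mink n}

local notation "𝔼" => EuclideanSpace ℝ (Fin d)

theorem IsNormalAt.neg (h : IsNormalAt f k N x) : IsNormalAt f k (-N) x where
  contDiff := h.contDiff
  mem_hyp := h.mem_hyp
  injective := h.injective
  normal_self := by rw [lorentz_neg_left, lorentz_neg_right, h.normal_self, neg_neg]
  normal_pos := by rw [lorentz_neg_left, h.normal_pos, neg_zero]
  normal_tangent u := by rw [lorentz_neg_left, h.normal_tangent, neg_zero]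

theorem IsNormalAt.eq_smul (h : IsNormalAt f k N x) (hk : 0 < k) (hd : d + 1 = n) {Z : Mink n}
    (h1 : lorentz Z (f x) = 0) (h3 : ∀ u, lorentz Z (fderiv ℝ f x u) = 0) :
    Z = lorentz Z N • N := by
  rw [← sub_eq_zero]
  refine h.eq_zero hk hd ?_ ?_ fun u => ?_
  · rw [lorentz_sub_left, lorentz_smul_left, h1, h.normal_pos]; simp
  · rw [lorentz_sub_left, lorentz_smul_left, h.normal_self]; simp
  · rw [lorentz_sub_left, lorentz_smul_left, h3, h.normal_tangent]; simp

/-- A vector whose hyperplane supports the surface is normal to it. -/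
theorem IsNormalAt.eq_smul_of_isLocalMax (h : IsNormalAt f k N x) (hk : 0 < k) (hd : d + 1 = n)
    {Z : Mink n} (h1 : lorentz Z (f x) = 0) (hmax : IsLocalMax (fun z => lorentz Z (f z)) x) :
    Z = lorentz Z N • N := by
  refine h.eq_smul hk hd h1 fun u => ?_
  have h2 := fderiv_lorentz_apply (hasFDerivAt_const Z x)
    (h.contDiff.self_of_nhds.differentiableAt (by simp)).hasFDerivAt u
  rw [hmax.fderiv_eq_zero, zero_apply, lorentz_comm _ (f x), zero_apply, lorentz_zero_right,
    zero_add] at h2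
  exact h2.symm

/-- The second fundamental form of a hypersurface whose sectional curvatures exceed those of the
ambient space is definite. -/
theorem IsNormalAt.definite (h : IsNormalAt f k N x) (hk : 0 < k) (hd : d + 1 = n) (hd2 : 2 ≤ d)
    (hsec : ∀ u w : 𝔼, LinearIndependent ℝ ![u, w] → -k ^ 2 < sectional (gram f) x u w) :
    (∀ u, u ≠ 0 → lorentz N (fderiv ℝ (fderiv ℝ f) x u u) < 0) ∨
      ∀ u, u ≠ 0 → lorentz (-N) (fderiv ℝ (fderiv ℝ f) x u u) < 0 := by
  set H : 𝔼 → ℝ := fun u => lorentz N (fderiv ℝ (fderiv ℝ f) x u u) with hH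
  have hfin : 1 < Module.finrank ℝ 𝔼 := by
    rw [finrank_euclideanSpace, Fintype.card_fin]; omega
  have hli : ∀ u w : 𝔼, LinearIndependent ℝ ![u, w] → 0 < H u * H w := by
    intro u w huw
    have := h.secondForm_det_pos hk hd huw (hsec u w huw)
    simp only [lorentz_comm _ N] at this
    exact (sq_nonneg _).trans_lt this
  have hprod : ∀ u w : 𝔼, u ≠ 0 → w ≠ 0 → 0 < H u * H w := by
    intro u w hu hw
    by_cases huw : LinearIndependent ℝ ![u, w]
    · exact hli u w huw
    · obtain ⟨v, hv⟩ := exists_linearIndependent_pair_of_one_lt_finrank hfin hu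
      have hu0 : H u ≠ 0 := left_ne_zero_of_mul (hli u v hv).ne'
      rw [LinearIndependent.pair_iff' hu] at huw
      push Not at huw
      obtain ⟨c, rfl⟩ := huw
      have hc : c ≠ 0 := fun h0 => hw (by rw [h0, zero_smul])
      have : H (c • u) = c ^ 2 * H u := by
        simp only [hH, map_smul, smul_apply, smul_smul, lorentz_smul_right]
        ring
      rw [this]
      have e : H u * (c ^ 2 * H u) = (c * H u) ^ 2 := by ring
      rw [e]
      positivity
  have : Nontrivial 𝔼 := Module.nontrivial_of_finrank_pos (zero_lt_one.trans hfin)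
  obtain ⟨u₀, hu₀⟩ := exists_ne (0 : 𝔼)
  rcases lt_or_ge (H u₀) 0 with h0 | h0
  · exact Or.inl fun u hu => by have := hprod u₀ u hu₀ hu; simp only [hH] at *; nlinarith
  · refine Or.inr fun u hu => ?_
    have := hprod u₀ u hu₀ hu
    rw [lorentz_neg_left]
    simp only [hH] at *
    nlinarith

/-- Projection of `N` to the orthogonal complement of the tangent space and of the position
vector. -/
def normalField (f : 𝔼 → Mink n) (k : ℝ) (N : Mink n) (x : 𝔼) : Mink n :=
  N + (k ^ 2 * lorentz N (f x)) • f x -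
    ∑ j, ∑ i, ((gram f x)⁻¹ i j * lorentz N (pd j f x)) • pd i f x

theorem continuousAt_normalField (hf : ContDiffAt ℝ ∞ f x) (hdet : (gram f x).det ≠ 0) :
    ContinuousAt (normalField f k N) x := by
  have h1 : ∀ i, ContDiffAt ℝ ∞ (pd i f) x := contDiffAt_pd hf
  have h2 : ContDiffAt ℝ ∞ (normalField f k N) x := by
    refine (contDiffAt_const.add ((contDiffAt_const.mul
      (contDiffAt_lorentz contDiffAt_const hf)).smul hf)).sub ?_
    exact ContDiffAt.sum fun j _ => ContDiffAt.sum fun i _ =>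
      ((contDiffAt_matrix_inv (contDiffAt_gram hf) hdet i j).mul
        (contDiffAt_lorentz contDiffAt_const (h1 j))).smul (h1 i)
  exact h2.continuousAt

theorem normalField_self (h : IsNormalAt f k N x) : normalField f k N x = N := by
  have : ∀ i, lorentz N (pd i f x) = 0 := fun i => h.normal_tangent _
  simp [normalField, h.normal_pos, this]

theorem lorentz_normalField (hk : 0 < k) (hf : ContDiffAt ℝ ∞ f x)
    (hm : ∀ᶠ z in 𝓝 x, f z ∈ Hyp n k) (hdet : (gram f x).det ≠ 0) :
    lorentz (normalField f k N x) (f x) = 0 ∧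
      ∀ u, lorentz (normalField f k N x) (fderiv ℝ f x u) = 0 := by
  have htan := lorentz_fderiv_eq_zero (hf.differentiableAt (by simp)) hm
  have hpd : ∀ l, lorentz (f x) (pd l f x) = 0 := fun l => htan _
  constructor
  · have hpd' : ∀ l, lorentz (pd l f x) (f x) = 0 := fun l => by rw [lorentz_comm, hpd]
    simp only [normalField, lorentz_sub_left, lorentz_add_left, lorentz_smul_left,
      lorentz_sum_left, hpd', hm.self_of_nhds.1]
    field_simp
    simp
  · intro u
    rw [← sum_smul_pd, lorentz_sum_right]
    refine Finset.sum_eq_zero fun m _ => ?_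
    rw [lorentz_smul_right]
    refine mul_eq_zero_of_right _ ?_
    simp only [normalField, lorentz_sub_left, lorentz_add_left, lorentz_smul_left,
      lorentz_sum_left, hpd]
    have h1 : ∀ j, ∑ i, (gram f x)⁻¹ i j * lorentz N (pd j f x) * lorentz (pd i f x) (pd m f x) =
        lorentz N (pd j f x) * (1 : Matrix (Fin d) (Fin d) ℝ) m j := by
      intro j
      rw [← Matrix.mul_nonsing_inv _ (isUnit_iff_ne_zero.2 hdet), Matrix.mul_apply,
        Finset.mul_sum]
      refine Finset.sum_congr rfl fun i _ => ?_
      rw [gram_apply, lorentz_comm (pd m f x)]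
      ring
    simp [h1, Matrix.one_apply]

theorem injective_fderiv_of_det_ne_zero (hdet : (gram f x).det ≠ 0) :
    Function.Injective (fderiv ℝ f x) := by
  rw [injective_iff_map_eq_zero]
  intro u hu
  have h1 : (gram f x).mulVec u = 0 := by
    funext i
    have h2 : lorentz (pd i f x) (fderiv ℝ f x u) = 0 := by rw [hu, lorentz_zero_right]
    rw [← sum_smul_pd, lorentz_sum_right] at h2
    simp only [lorentz_smul_right] at h2
    rw [Matrix.mulVec, dotProduct, Pi.zero_apply, ← h2]
    exact Finset.sum_congr rfl fun j _ => by rw [gram_apply, mul_comm]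
  have h3 := Matrix.eq_zero_of_mulVec_eq_zero hdet h1
  ext i
  exact congrFun h3 i

/-- The functional `lorentz v`. -/
def lorentzL (v : Mink n) : Mink n →L[ℝ] ℝ := LinearMap.toContinuousLinearMap (lorentzBilin n v)

theorem neg_of_second_derivative_neg {h h' h'' : ℝ → ℝ}
    (hd : ∀ t ∈ Icc (0 : ℝ) 1, HasDerivAt h (h' t) t)
    (hd' : ∀ t ∈ Icc (0 : ℝ) 1, HasDerivAt h' (h'' t) t) (h0 : h 0 = 0) (h0' : h' 0 = 0)
    (hneg : ∀ t ∈ Icc (0 : ℝ) 1, h'' t < 0) : h 1 < 0 := by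
  have h1 : StrictAntiOn h' (Icc 0 1) := by
    refine strictAntiOn_of_deriv_neg (convex_Icc 0 1)
      (fun t ht => (hd' t ht).continuousAt.continuousWithinAt) fun t ht => ?_
    rw [(hd' t (interior_subset ht)).deriv]
    exact hneg t (interior_subset ht)
  have h2 : StrictAntiOn h (Icc 0 1) := by
    refine strictAntiOn_of_deriv_neg (convex_Icc 0 1)
      (fun t ht => (hd t ht).continuousAt.continuousWithinAt) fun t ht => ?_
    rw [(hd t (interior_subset ht)).deriv, ← h0']
    rw [interior_Icc] at ht
    exact h1 (by simp) (Ioo_subset_Icc_self ht) ht.1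
  rw [← h0]
  exact h2 (by simp) (by simp) one_pos

theorem continuousAt_lorentz {X : Type*} [TopologicalSpace X] {u w : X → Mink n} {x : X}
    (hu : ContinuousAt u x) (hw : ContinuousAt w x) :
    ContinuousAt (fun q => lorentz (u q) (w q)) x := by
  unfold lorentz
  exact (hu.fst.inner hw.fst).sub (hu.snd.mul hw.snd)

/-- If the second fundamental form at `x` is definite, the surface lies near `x` strictly on one
side of each of its tangent hyperplanes. -/
theorem IsNormalAt.eventually_strictly_convex (h : IsNormalAt f k N x) (hk : 0 < k)
    (hneg : ∀ u, u ≠ 0 → lorentz N (fderiv ℝ (fderiv ℝ f) x u u) < 0) :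
    ∃ ε > 0, ∀ y ∈ Metric.ball x ε, ∀ z ∈ Metric.ball x ε, z ≠ y →
      lorentz (normalField f k N y) (f z) < 0 := by
  have hdet := h.det_ne_zero hk
  have hc := h.contDiff.self_of_nhds
  have hev1 : ∀ᶠ p : 𝔼 × 𝔼 in 𝓝 (x, x), ∀ u ∈ Metric.sphere (0 : 𝔼) 1,
      lorentz (normalField f k N p.1) (fderiv ℝ (fderiv ℝ f) p.2 u u) < 0 := by
    refine (isCompact_sphere (0 : 𝔼) 1).eventually_forall_of_forall_eventually
      (P := fun (p : 𝔼 × 𝔼) u =>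
        lorentz (normalField f k N p.1) (fderiv ℝ (fderiv ℝ f) p.2 u u) < 0) fun u hu => ?_
    have h1 : Tendsto (fun q : (𝔼 × 𝔼) × 𝔼 => q.1.1) (𝓝 ((x, x), u)) (𝓝 x) :=
      (continuous_fst.comp continuous_fst).tendsto' _ _ rfl
    have h2 : Tendsto (fun q : (𝔼 × 𝔼) × 𝔼 => q.1.2) (𝓝 ((x, x), u)) (𝓝 x) :=
      (continuous_snd.comp continuous_fst).tendsto' _ _ rfl
    have hb : ContinuousAt (fun q : (𝔼 × 𝔼) × 𝔼 => normalField f k N q.1.1) ((x, x), u) :=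
      (continuousAt_normalField hc hdet).tendsto.comp h1
    have h3 : ContDiffAt ℝ ∞ (fderiv ℝ (fderiv ℝ f)) x :=
      (hc.fderiv_right (m := ∞) (by simp)).fderiv_right (m := ∞) (by simp)
    have hD : ContinuousAt (fun q : (𝔼 × 𝔼) × 𝔼 => fderiv ℝ (fderiv ℝ f) q.1.2) ((x, x), u) :=
      h3.continuousAt.tendsto.comp h2
    have hu2 : ContinuousAt (fun q : (𝔼 × 𝔼) × 𝔼 => q.2) ((x, x), u) := continuousAt_snd
    have hcont : ContinuousAt (fun q : (𝔼 × 𝔼) × 𝔼 =>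
        lorentz (normalField f k N q.1.1) (fderiv ℝ (fderiv ℝ f) q.1.2 q.2 q.2)) ((x, x), u) :=
      continuousAt_lorentz hb ((hD.clm_apply hu2).clm_apply hu2)
    refine hcont.eventually (gt_mem_nhds ?_)
    simp only [normalField_self h]
    exact hneg u (by rintro rfl; simp at hu)
  rw [nhds_prod_eq] at hev1
  obtain ⟨P, hP, Q, hQ, hPQ⟩ := eventually_prod_iff.1 hev1
  have hev2 := hP.and (hQ.and (h.contDiff.and (h.mem_hyp.eventually_nhds.and
    (eventually_det_ne hc hdet))))
  obtain ⟨ε, hε, hball⟩ := Metric.mem_nhds_iff.1 hev2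
  refine ⟨ε, hε, fun y hy z hz hne => ?_⟩
  obtain ⟨hPy, -, hcy, hmy, hdy⟩ := hball hy
  obtain ⟨hb0, hb1⟩ := lorentz_normalField (N := N) hk hcy hmy hdy
  set v := z - y with hv
  have hv0 : v ≠ 0 := sub_ne_zero.2 hne
  have hγ : ∀ t ∈ Icc (0 : ℝ) 1, y + t • v ∈ Metric.ball x ε := by
    intro t ht
    refine (convex_iff_segment_subset.1 (convex_ball x ε)) hy hz ?_
    rw [segment_eq_image']
    exact ⟨t, ht, rfl⟩
  have hline : ∀ t : ℝ, HasDerivAt (fun t : ℝ => y + t • v) v t := fun t => by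
    simpa using ((hasDerivAt_id t).smul_const v).const_add y
  have key := neg_of_second_derivative_neg
    (h := fun t => lorentz (normalField f k N y) (f (y + t • v)))
    (h' := fun t => lorentz (normalField f k N y) (fderiv ℝ f (y + t • v) v))
    (h'' := fun t => lorentz (normalField f k N y) (fderiv ℝ (fderiv ℝ f) (y + t • v) v v))
    (fun t ht => ?_) (fun t ht => ?_) (by simpa using hb0) (by simpa using hb1 v) (fun t ht => ?_)
  · simpa [hv] using key
  · have hct : ContDiffAt ℝ ∞ f (y + t • v) := (hball (hγ t ht)).2.2.1
    have h1 := (hct.differentiableAt (by simp)).hasFDerivAt.comp_hasDerivAt t (hline t)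
    exact (lorentzL (normalField f k N y)).hasFDerivAt.comp_hasDerivAt t h1
  · have hct : ContDiffAt ℝ ∞ f (y + t • v) := (hball (hγ t ht)).2.2.1
    have h1 := ((hct.fderiv_right (m := ∞) (by simp)).differentiableAt
      (by simp)).hasFDerivAt.comp_hasDerivAt t (hline t)
    have h2 := h1.clm_apply (hasDerivAt_const t v)
    simp only [map_zero, add_zero] at h2
    exact (lorentzL (normalField f k N y)).hasFDerivAt.comp_hasDerivAt t h2
  · have h1 := hPQ hPy (hball (hγ t ht)).2.1 (‖v‖⁻¹ • v)
      (by simp [norm_smul, norm_ne_zero_iff.2 hv0])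
    simp only [map_smul, smul_apply, lorentz_smul_right] at h1
    have hvn := inv_pos.2 (norm_pos_iff.2 hv0)
    by_contra hcon
    have := mul_nonneg hvn.le (mul_nonneg hvn.le (not_lt.1 hcon))
    linarith

end LocalConvexity

/-! ### Hypersurfaces in charts -/

section Charts

variable {n : ℕ} {k : ℝ} {S : Type*} [TopologicalSpace S]
  [ChartedSpace (EuclideanSpace ℝ (Fin (n - 1))) S]

/-- The hypersurface in the preferred chart around `p`. -/
def inChart (F : S → Hyp n k) (p : S) : EuclideanSpace ℝ (Fin (n - 1)) → Mink n :=
  position F ∘ (extChartAt (𝓡 (n - 1)) p).symm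

variable {F : S → Hyp n k}

theorem mfderiv_position_eq (hF : ContMDiff (𝓡 (n - 1)) 𝓘(ℝ, Mink n) ∞ (position F)) (p : S) :
    mfderiv (𝓡 (n - 1)) 𝓘(ℝ, Mink n) (position F) p =
      fderiv ℝ (inChart F p) (extChartAt (𝓡 (n - 1)) p p) := by
  have h1 : MDifferentiableAt (𝓡 (n - 1)) 𝓘(ℝ, Mink n) (position F) p :=
    hF.mdifferentiable (by simp) p
  rw [h1.mfderiv]
  simp only [ModelWithCorners.range_eq_univ, fderivWithin_univ]
  rfl

theorem inChart_apply_self (F : S → Hyp n k) (p : S) :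
    inChart F p (extChartAt (𝓡 (n - 1)) p p) = F p := by
  rw [inChart, Function.comp_apply, extChartAt_to_inv, position]

variable [IsManifold (𝓡 (n - 1)) ∞ S]

theorem contDiffAt_inChart (hF : ContMDiff (𝓡 (n - 1)) 𝓘(ℝ, Mink n) ∞ (position F)) (p : S)
    {z : EuclideanSpace ℝ (Fin (n - 1))} (hz : z ∈ (extChartAt (𝓡 (n - 1)) p).target) :
    ContDiffAt ℝ ∞ (inChart F p) z := by
  have h1 : ContMDiffOn 𝓘(ℝ, EuclideanSpace ℝ (Fin (n - 1))) 𝓘(ℝ, Mink n) ∞ (inChart F p)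
      (extChartAt (𝓡 (n - 1)) p).target :=
    hF.comp_contMDiffOn (contMDiffOn_extChartAt_symm p)
  exact (contMDiffOn_iff_contDiffOn.1 h1).contDiffAt ((isOpen_extChartAt_target p).mem_nhds hz)

theorem fderiv_inChart_mem_range (hF : ContMDiff (𝓡 (n - 1)) 𝓘(ℝ, Mink n) ∞ (position F)) (p : S)
    {z : EuclideanSpace ℝ (Fin (n - 1))} (hz : z ∈ (extChartAt (𝓡 (n - 1)) p).target)
    (u : EuclideanSpace ℝ (Fin (n - 1))) :
    ∃ v : TangentSpace (𝓡 (n - 1)) ((extChartAt (𝓡 (n - 1)) p).symm z),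
      fderiv ℝ (inChart F p) z u =
        mfderiv (𝓡 (n - 1)) 𝓘(ℝ, Mink n) (position F) ((extChartAt (𝓡 (n - 1)) p).symm z) v := by
  have h1 : MDifferentiableAt 𝓘(ℝ, EuclideanSpace ℝ (Fin (n - 1))) (𝓡 (n - 1))
      (extChartAt (𝓡 (n - 1)) p).symm z :=
    ((contMDiffOn_extChartAt_symm (n := ∞) p).contMDiffAt
      ((isOpen_extChartAt_target p).mem_nhds hz)).mdifferentiableAt (by simp)
  have h2 : MDifferentiableAt (𝓡 (n - 1)) 𝓘(ℝ, Mink n) (position F)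
      ((extChartAt (𝓡 (n - 1)) p).symm z) := hF.mdifferentiable (by simp) _
  have h3 := mfderiv_comp z h2 h1
  rw [mfderiv_eq_fderiv] at h3
  refine ⟨mfderiv 𝓘(ℝ, EuclideanSpace ℝ (Fin (n - 1))) (𝓡 (n - 1))
    (extChartAt (𝓡 (n - 1)) p).symm z u, ?_⟩
  exact congrArg (fun L => L u) h3

/-- `N` is a field of unit normal vectors of the hypersurface. -/
def IsUnitNormal (F : S → Hyp n k) (N : S → Mink n) : Prop :=
  ∀ p, lorentz (N p) (N p) = 1 ∧ lorentz (N p) (F p : Mink n) = 0 ∧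
    ∀ v : TangentSpace (𝓡 (n - 1)) p,
      lorentz (N p) (mfderiv (𝓡 (n - 1)) 𝓘(ℝ, Mink n) (position F) p v : Mink n) = 0

theorem isNormalAt_of_injective (hF : IsSmoothEmb F) {N : S → Mink n} (hN : IsUnitNormal F N)
    (p : S) {z : EuclideanSpace ℝ (Fin (n - 1))} (hz : z ∈ (extChartAt (𝓡 (n - 1)) p).target)
    (hinj : Function.Injective (fderiv ℝ (inChart F p) z)) :
    IsNormalAt (inChart F p) k (N ((extChartAt (𝓡 (n - 1)) p).symm z)) z where
  contDiff := by
    filter_upwards [(isOpen_extChartAt_target p).mem_nhds hz] with w hw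
    exact contDiffAt_inChart hF.1 p hw
  mem_hyp := Eventually.of_forall fun w => (F _).2
  injective := hinj
  normal_self := (hN _).1
  normal_pos := (hN _).2.1
  normal_tangent u := by
    obtain ⟨v, hv⟩ := fderiv_inChart_mem_range hF.1 p hz u
    rw [hv]
    exact (hN _).2.2 v

theorem isNormalAt_center (hF : IsSmoothEmb F) {N : S → Mink n} (hN : IsUnitNormal F N) (p : S) :
    IsNormalAt (inChart F p) k (N p) (extChartAt (𝓡 (n - 1)) p p) := by
  have h := isNormalAt_of_injective hF hN p (mem_extChartAt_target p)
    (by rw [← mfderiv_position_eq hF.1 p]; exact hF.2.2 p)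
  rwa [extChartAt_to_inv] at h

/-- At every point one of the two unit normals makes the hypersurface locally strictly convex. -/
theorem exists_locally_convex (hn : 3 ≤ n) (hk : 0 < k) (hF : IsSmoothEmb F)
    (hK : SectionalCurvatureGT F (-k ^ 2)) {N : S → Mink n} (hN : IsUnitNormal F N) (p : S) :
    ∃ σ : ℝ, (σ = 1 ∨ σ = -1) ∧ ∃ V ∈ 𝓝 p, ∃ b : S → Mink n, ContinuousAt b p ∧ b p = σ • N p ∧
      ∀ q ∈ V, (∃ c : ℝ, b q = c • N q) ∧
        ∀ q' ∈ V, q' ≠ q → lorentz (b q) (F q' : Mink n) < 0 := by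
  have hd : n - 1 + 1 = n := by omega
  have h := isNormalAt_center hF hN p
  have hdef := h.definite hk hd (by omega) fun u w huw => hK p u w (by
    rw [LinearIndependent.pair_iff] at huw ⊢
    intro s t hst
    refine huw s t ?_
    ext i
    exact congrFun hst i)
  obtain ⟨σ, hσ, hσN, hneg⟩ : ∃ σ : ℝ, (σ = 1 ∨ σ = -1) ∧
      IsNormalAt (inChart F p) k (σ • N p) (extChartAt (𝓡 (n - 1)) p p) ∧
      ∀ u, u ≠ 0 → lorentz (σ • N p)
        (fderiv ℝ (fderiv ℝ (inChart F p)) (extChartAt (𝓡 (n - 1)) p p) u u) < 0 := by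
    rcases hdef with h1 | h1
    · exact ⟨1, Or.inl rfl, by rwa [one_smul], by rwa [one_smul]⟩
    · exact ⟨-1, Or.inr rfl, by rw [neg_one_smul]; exact h.neg, by rwa [neg_one_smul]⟩
  obtain ⟨ε, hε, hconv⟩ := hσN.eventually_strictly_convex hk hneg
  have hc := h.contDiff.self_of_nhds
  have hdet := h.det_ne_zero hk
  have hcont := continuousAt_extChartAt (I := 𝓡 (n - 1)) p
  refine ⟨σ, hσ, {q | q ∈ (extChartAt (𝓡 (n - 1)) p).source ∧
    extChartAt (𝓡 (n - 1)) p q ∈ Metric.ball (extChartAt (𝓡 (n - 1)) p p) ε ∧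
    (gram (inChart F p) (extChartAt (𝓡 (n - 1)) p q)).det ≠ 0}, ?_,
    fun q => normalField (inChart F p) k (σ • N p) (extChartAt (𝓡 (n - 1)) p q), ?_, ?_, ?_⟩
  · exact Eventually.and (extChartAt_source_mem_nhds p)
      ((hcont.eventually (Metric.ball_mem_nhds _ hε)).and
        (hcont.eventually (eventually_det_ne hc hdet)))
  · exact ContinuousAt.comp (continuousAt_normalField hc hdet) hcont
  · exact normalField_self hσN
  · rintro q ⟨hqs, hqb, hqd⟩
    have hqt := (extChartAt (𝓡 (n - 1)) p).map_source hqs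
    have hcq := contDiffAt_inChart hF.1 p hqt
    obtain ⟨hb0, hb1⟩ := lorentz_normalField (N := σ • N p) hk hcq
      (Eventually.of_forall fun w => (F _).2) hqd
    refine ⟨?_, ?_⟩
    · have hq := isNormalAt_of_injective hF hN p hqt (injective_fderiv_of_det_ne_zero hqd)
      rw [(extChartAt (𝓡 (n - 1)) p).left_inv hqs] at hq
      exact ⟨_, hq.eq_smul hk hd hb0 hb1⟩
    · rintro q' ⟨hqs', hqb', -⟩ hne
      have h1 := hconv _ hqb _ hqb' fun h0 =>
        hne ((extChartAt (𝓡 (n - 1)) p).injOn hqs' hqs h0)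
      rwa [inChart, Function.comp_apply, (extChartAt (𝓡 (n - 1)) p).left_inv hqs'] at h1

/-- A vector whose hyperplane supports the hypersurface is normal to it. -/
theorem eq_smul_normal_of_support (hn : 3 ≤ n) (hk : 0 < k) (hF : IsSmoothEmb F)
    {N : S → Mink n} (hN : IsUnitNormal F N) (p : S) {Z : Mink n}
    (h0 : lorentz Z (F p : Mink n) = 0) (hle : ∀ q, lorentz Z (F q : Mink n) ≤ 0) :
    ∃ c : ℝ, Z = c • N p := by
  refine ⟨_, (isNormalAt_center hF hN p).eq_smul_of_isLocalMax hk (by omega) ?_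
    (Eventually.of_forall fun z => ?_)⟩
  · rw [inChart_apply_self, h0]
  · simp only [inChart_apply_self, h0]
    exact hle _

end Charts

end HypFoliation

end

noncomputable section

namespace HypFoliation

/-! ### The projective model -/

section Klein

variable {n : ℕ} {k : ℝ}

/-- The projective (Klein) model of hyperbolic space, in which geodesics are line segments. -/
def klein (X : Mink n) : EuclideanSpace ℝ (Fin n) := X.2⁻¹ • X.1

/-- The inverse of the projective model. -/
def kleinInv (k : ℝ) (u : EuclideanSpace ℝ (Fin n)) : Mink n :=
  (k * √(1 - ‖u‖ ^ 2))⁻¹ • (u, 1)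

theorem inner_klein_sub {Z X Y : Mink n} (hX : X.2 ≠ 0) (hY : Y.2 ≠ 0) (hZ : lorentz Z Y = 0) :
    inner ℝ Z.1 (klein X - klein Y) = lorentz Z X / X.2 := by
  rw [lorentz] at hZ ⊢
  rw [inner_sub_right, klein, klein, real_inner_smul_right, real_inner_smul_right]
  have : inner ℝ Z.1 Y.1 = Z.2 * Y.2 := by linarith
  rw [this]
  field_simp

theorem norm_klein_lt_one (hk : 0 < k) {X : Mink n} (hX : X ∈ Hyp n k) : ‖klein X‖ < 1 := by
  have h1 := Hyp.norm_sq hk hX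
  have h2 : ‖X.1‖ < X.2 := by
    have h3 : k * ‖X.1‖ < k * X.2 := by
      refine (sq_lt_sq₀ (by positivity) (mul_pos hk hX.2).le).1 ?_
      linarith
    exact lt_of_mul_lt_mul_left h3 hk.le
  rw [klein, norm_smul, norm_inv, Real.norm_of_nonneg hX.2.le, inv_mul_lt_one₀ hX.2]
  exact h2

theorem kleinInv_klein (hk : 0 < k) {X : Mink n} (hX : X ∈ Hyp n k) :
    kleinInv k (klein X) = X := by
  have h1 := Hyp.norm_sq hk hX
  have hX2 := hX.2
  have h2 : √(1 - ‖klein X‖ ^ 2) = (k * X.2)⁻¹ := by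
    rw [← Real.sqrt_sq (inv_pos.2 (mul_pos hk hX2)).le]
    congr 1
    rw [klein, norm_smul, norm_inv, Real.norm_of_nonneg hX2.le]
    field_simp
    linarith
  rw [kleinInv, h2, klein]
  ext1
  · simp only [Prod.smul_mk, smul_smul]
    rw [show (k * (k * X.2)⁻¹)⁻¹ * X.2⁻¹ = 1 by field_simp, one_smul]
  · simp only [Prod.smul_mk, smul_eq_mul]
    field_simp

theorem kleinInv_mem (hk : 0 < k) {u : EuclideanSpace ℝ (Fin n)} (hu : ‖u‖ < 1) :
    kleinInv k u ∈ Hyp n k := by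
  have h1 : 0 < 1 - ‖u‖ ^ 2 := by nlinarith [norm_nonneg u]
  have h2 := Real.sqrt_pos.2 h1
  refine ⟨?_, ?_⟩
  · rw [kleinInv, lorentz_smul_left, lorentz_smul_right, lorentz_self]
    simp only [one_pow]
    have h3 := Real.sq_sqrt h1.le
    generalize √(1 - ‖u‖ ^ 2) = s at *
    field_simp
    linarith
  · simp only [kleinInv, Prod.smul_mk, smul_eq_mul, mul_one]
    positivity

theorem klein_kleinInv (hk : 0 < k) {u : EuclideanSpace ℝ (Fin n)} (hu : ‖u‖ < 1) :
    klein (kleinInv k u) = u := by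
  have h1 : 0 < 1 - ‖u‖ ^ 2 := by nlinarith [norm_nonneg u]
  have h2 := Real.sqrt_pos.2 h1
  simp only [klein, kleinInv, Prod.smul_mk, smul_eq_mul, mul_one, smul_smul, inv_inv]
  rw [mul_inv_cancel₀ (by positivity), one_smul]

theorem klein_injOn (hk : 0 < k) : InjOn (klein (n := n)) (Hyp n k) := fun X hX Y hY h => by
  rw [← kleinInv_klein hk hX, h, kleinInv_klein hk hY]

theorem continuous_klein : Continuous fun X : Hyp n k => klein (X : Mink n) := by
  unfold klein
  exact ((continuous_snd.comp continuous_subtype_val).inv₀ fun X => X.2.2.ne').smul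
    (continuous_fst.comp continuous_subtype_val)

theorem continuousOn_kleinInv (hk : 0 < k) :
    ContinuousOn (kleinInv (n := n) k) (Metric.ball 0 1) := by
  have h0 : Continuous fun u : EuclideanSpace ℝ (Fin n) => k * √(1 - ‖u‖ ^ 2) := by fun_prop
  have h1 : Continuous fun u : EuclideanSpace ℝ (Fin n) => (u, (1 : ℝ)) := by fun_prop
  refine (h0.continuousOn.inv₀ fun u hu => ?_).smul h1.continuousOn
  rw [mem_ball_zero_iff] at hu
  have h1 : 0 < 1 - ‖u‖ ^ 2 := by nlinarith [norm_nonneg u]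
  have h2 := Real.sqrt_pos.2 h1
  positivity

theorem isOpen_image_klein (hk : 0 < k) {Ω : Set (Hyp n k)} (hΩ : IsOpen Ω) :
    IsOpen ((fun X : Hyp n k => klein (X : Mink n)) '' Ω) := by
  obtain ⟨O, hO, rfl⟩ := isOpen_induced_iff.1 hΩ
  convert (continuousOn_kleinInv (n := n) hk).isOpen_inter_preimage Metric.isOpen_ball hO using 1
  ext u
  constructor
  · rintro ⟨X, hX, rfl⟩
    refine ⟨mem_ball_zero_iff.2 (norm_klein_lt_one hk X.2), ?_⟩
    rw [mem_preimage, kleinInv_klein hk X.2]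
    exact hX
  · rintro ⟨hu, huO⟩
    rw [mem_ball_zero_iff] at hu
    exact ⟨⟨kleinInv k u, kleinInv_mem hk hu⟩, huO, klein_kleinInv hk hu⟩

theorem isClosed_Hyp (hk : 0 < k) : IsClosed (Hyp n k) := by
  have h : Hyp n k = {X | lorentz X X = -(1 / k ^ 2)} ∩ {X | 1 ≤ k * X.2} := by
    ext X
    refine ⟨fun hX => ⟨hX.1, Hyp.one_le hk hX⟩, fun hX => ⟨hX.1, ?_⟩⟩
    exact pos_of_mul_pos_right (one_pos.trans_le hX.2) hk.le
  rw [h]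
  exact (isClosed_eq continuous_lorentz continuous_const).inter
    (isClosed_le continuous_const (by fun_prop))

theorem closure_subset_of_subset_geodBall (hk : 0 < k) {Ω : Set (Hyp n k)} {R : ℝ} (hR : 0 ≤ R)
    (h : Ω ⊆ geodBall n k R) {X : Hyp n k} (hX : X ∈ closure Ω) :
    k * (X : Mink n).2 ≤ Real.cosh (k * R) := by
  refine closure_minimal (t := {X : Hyp n k | k * (X : Mink n).2 ≤ Real.cosh (k * R)})
    (fun Y hY => ((radius_lt_iff hk Y.2 hR).1 (h hY)).le) ?_ hX
  exact isClosed_le (continuous_const.mul (continuous_snd.comp continuous_subtype_val))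
    continuous_const

theorem isCompact_closure_of_subset_geodBall (hk : 0 < k) {Ω : Set (Hyp n k)} {R : ℝ} (hR : 0 ≤ R)
    (h : Ω ⊆ geodBall n k R) : IsCompact (closure Ω) := by
  have hK : IsCompact ((Subtype.val : Hyp n k → Mink n) ⁻¹'
      Metric.closedBall 0 (Real.cosh (k * R) / k)) :=
    (isClosed_Hyp hk).isClosedEmbedding_subtypeVal.isCompact_preimage (isCompact_closedBall _ _)
  refine hK.of_isClosed_subset isClosed_closure fun X hX => ?_
  have h1 := closure_subset_of_subset_geodBall hk hR h hX
  have h2 := Hyp.norm_sq hk X.2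
  have h3 := X.2.2
  rw [mem_preimage, mem_closedBall_zero_iff, Prod.norm_def, max_le_iff,
    Real.norm_of_nonneg h3.le, le_div_iff₀' hk, le_div_iff₀' hk]
  refine ⟨le_trans ?_ h1, h1⟩
  refine (sq_le_sq₀ (by positivity) (by positivity)).1 ?_
  linarith

theorem frontier_image_klein (hk : 0 < k) {Ω : Set (Hyp n k)} (hΩ : IsOpen Ω) {R : ℝ}
    (hR : 0 ≤ R) (h : Ω ⊆ geodBall n k R) :
    frontier ((fun X : Hyp n k => klein (X : Mink n)) '' Ω) =
      (fun X : Hyp n k => klein (X : Mink n)) '' frontier Ω := by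
  have hinj : Function.Injective fun X : Hyp n k => klein (X : Mink n) := fun X Y hXY =>
    Subtype.ext (klein_injOn hk X.2 Y.2 hXY)
  have hcl : closure ((fun X : Hyp n k => klein (X : Mink n)) '' Ω) =
      (fun X : Hyp n k => klein (X : Mink n)) '' closure Ω := by
    refine subset_antisymm (closure_minimal (image_mono subset_closure) ?_)
      (image_closure_subset_closure_image continuous_klein)
    exact ((isCompact_closure_of_subset_geodBall hk hR h).image continuous_klein).isClosed
  rw [(isOpen_image_klein hk hΩ).frontier_eq, hΩ.frontier_eq, hcl, image_sdiff hinj]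

end Klein

/-! ### Enclosed regions -/

section Region

variable {n : ℕ} {k : ℝ} {S : Type*} [TopologicalSpace S]
  [ChartedSpace (EuclideanSpace ℝ (Fin (n - 1))) S]
  {F : S → Hyp n k} {Ω₀ : Set (Hyp n k)} {N : S → Mink n}

theorem IsOutwardUnitNormal.isUnitNormal (hN : IsOutwardUnitNormal F Ω₀ N) : IsUnitNormal F N :=
  fun p => ⟨(hN p).1, (hN p).2.1, (hN p).2.2.1⟩

variable [IsManifold (𝓡 (n - 1)) ∞ S]

/-- In the projective model the enclosed region has a locally strictly convex boundary. -/
theorem exists_hasConvexBoundary (hn : 3 ≤ n) (hk : 0 < k) (hF : IsSmoothEmb F)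
    (hK : SectionalCurvatureGT F (-k ^ 2)) (hΩ₀ : Encloses F Ω₀) (hN : IsUnitNormal F N) :
    ∃ σ : S → ℝ, (∀ p, σ p = 1 ∨ σ p = -1) ∧
      HasConvexBoundary ((fun X : Hyp n k => klein (X : Mink n)) '' Ω₀)
        (fun p => klein (F p : Mink n)) (fun p => σ p • (N p).1) := by
  choose σ hσ H using exists_locally_convex hn hk hF hK hN
  obtain ⟨ho, hc, ⟨R, hR⟩, hfr⟩ := hΩ₀
  have hR0 : 0 ≤ R := by
    obtain ⟨X, hX⟩ := hc.nonempty
    exact (radius_nonneg hk X.2).trans (hR hX).le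
  have hF0 : ∀ p, (F p : Mink n).2 ≠ 0 := fun p => (F p).2.2.ne'
  refine ⟨σ, hσ, ?_⟩
  constructor
  · exact isOpen_image_klein hk ho
  · exact hc.image _ continuous_klein.continuousOn
  · refine (Metric.isBounded_ball (x := 0) (r := 1)).subset ?_
    rintro _ ⟨X, -, rfl⟩
    exact mem_ball_zero_iff.2 (norm_klein_lt_one hk X.2)
  · have h1 : Continuous F := continuous_induced_rng.2 hF.1.continuous
    exact continuous_klein.comp h1
  · exact fun p q hpq => hF.2.1 (Subtype.ext (klein_injOn hk (F p).2 (F q).2 hpq))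
  · rw [frontier_image_klein hk ho hR0 hR, hfr, ← range_comp]
    rfl
  · intro p
    obtain ⟨V, hV, b, hb, hbp, hbV⟩ := H p
    refine ⟨V, hV, fun q => (b q).1, hb.fst, by simp [hbp], fun q hq => ⟨?_, fun q' hq' hne => ?_⟩⟩
    · obtain ⟨c, hcq⟩ := (hbV q hq).1
      refine ⟨c * σ q, ?_⟩
      have h2 : σ q * σ q = 1 := by rcases hσ q with h | h <;> rw [h] <;> norm_num
      simp only [smul_smul, mul_assoc, h2, mul_one, hcq, Prod.smul_fst]
    · obtain ⟨c, hcq⟩ := (hbV q hq).1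
      rw [inner_klein_sub (hF0 _) (hF0 _)
        (by rw [hcq, lorentz_smul_left, (hN q).2.1, mul_zero])]
      exact div_neg_of_neg_of_pos ((hbV q hq).2 q' hq' hne) (F q').2.2
  · intro p m hm
    have h0 : lorentz ((m, inner ℝ m (klein (F p : Mink n))) : Mink n) (F p) = 0 := by
      simp only [lorentz, klein, real_inner_smul_right]
      have := hF0 p
      field_simp
      simp
    obtain ⟨c, hcN⟩ := eq_smul_normal_of_support hn hk hF hN p h0 fun q => by
      have h1 := hm q
      rw [show inner ℝ m (klein (F q : Mink n) - klein (F p : Mink n)) = _ from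
        inner_klein_sub (hF0 q) (hF0 p) h0] at h1
      by_contra hcon
      exact absurd h1 (not_le.2 (div_pos (not_le.1 hcon) (F q).2.2))
    refine ⟨c * σ p, ?_⟩
    have h2 : σ p * σ p = 1 := by rcases hσ p with h | h <;> rw [h] <;> norm_num
    rw [smul_smul, mul_assoc, h2, mul_one]
    exact congrArg Prod.fst hcN

/-- The region enclosed by the hypersurface lies on the inner side of its tangent hyperplanes. -/
theorem lorentz_normal_neg (hn : 3 ≤ n) (hk : 0 < k) [CompactSpace S] [PreconnectedSpace S]
    [∀ p : S, (𝓝[≠] p).NeBot] (hF : IsSmoothEmb F)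
    (hK : SectionalCurvatureGT F (-k ^ 2)) (hΩ₀ : Encloses F Ω₀)
    (hN : IsOutwardUnitNormal F Ω₀ N) (p : S) {X : Hyp n k} (hX : X ∈ Ω₀) :
    lorentz (N p) (X : Mink n) < 0 := by
  obtain ⟨σ, hσ, h⟩ := exists_hasConvexBoundary hn hk hF hK hΩ₀ hN.isUnitNormal
  have : Nontrivial (EuclideanSpace ℝ (Fin n)) :=
    Module.nontrivial_of_finrank_pos (R := ℝ) (by
      rw [finrank_euclideanSpace, Fintype.card_fin]; omega)
  obtain ⟨hN1, hNF, -, hexit⟩ := hN p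
  have hFp := (F p).2.2
  set f : Mink n := (F p).1 with hf
  have hexits : ∃ᶠ t in 𝓝[>] (0 : ℝ), klein f + t • ((N p).1 - (N p).2 • klein f) ∉
      (fun X : Hyp n k => klein (X : Mink n)) '' Ω₀ := by
    set a : ℝ → ℝ := fun s => Real.cosh (k * s) with ha
    set b : ℝ → ℝ := fun s => 1 / k * Real.sinh (k * s) with hb
    set den : ℝ → ℝ := fun s => a s * f.2 + b s * (N p).2 with hden
    have hdc : Continuous den := by simp only [hden, ha, hb]; fun_prop
    have hbc : Continuous b := by simp only [hb]; fun_prop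
    have hd0 : 0 < den 0 := by simpa [hden, ha, hb] using hFp
    have hdev : ∀ᶠ s in 𝓝[>] (0 : ℝ), 0 < den s :=
      nhdsWithin_le_nhds (hdc.continuousAt.eventually (lt_mem_nhds hd0))
    have htend : Tendsto (fun s => b s / den s) (𝓝[>] 0) (𝓝[>] 0) := by
      refine tendsto_nhdsWithin_iff.2 ⟨?_, ?_⟩
      · have hc : ContinuousAt (fun s => b s / den s) 0 :=
          hbc.continuousAt.div hdc.continuousAt hd0.ne'
        have h0 : b 0 / den 0 = 0 := by simp [hb]
        have := hc.tendsto.mono_left (nhdsWithin_le_nhds (s := Ioi 0))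
        rwa [h0] at this
      · filter_upwards [hdev, eventually_mem_nhdsWithin] with s hs hs0
        have hs0 : 0 < s := hs0
        have : 0 < b s := by
          have := Real.sinh_pos_iff.2 (mul_pos hk hs0)
          simp only [hb]; positivity
        exact div_pos this hs
    refine htend.frequently (Eventually.frequently ?_)
    filter_upwards [hexit, hdev] with s hs hds
    have hflow : flow F N p s = a s • f + b s • N p := rfl
    have hmem : flow F N p s ∈ Hyp n k := by
      refine ⟨(lorentz_geodesic hk (F p).2.1 hN1 hNF s).1, ?_⟩
      rw [hflow]
      simpa [hden] using hds
    have hkl : klein f + (b s / den s) • ((N p).1 - (N p).2 • klein f) =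
        klein (flow F N p s) := by
      have e1 : (flow F N p s).2 = den s := by rw [hflow]; simp [hden]
      have e2 : (flow F N p s).1 = a s • f.1 + b s • (N p).1 := by rw [hflow]; simp
      rw [klein, klein, e1, e2]
      simp only [smul_sub, smul_add, smul_smul]
      have e3 : f.2⁻¹ - b s / den s * ((N p).2 * f.2⁻¹) = (den s)⁻¹ * a s := by
        field_simp
        simp only [hden]
        ring
      rw [← e3, sub_smul, div_eq_inv_mul]
      abel
    rw [hkl]
    rintro ⟨Y, hY, hYeq⟩
    exact hs ⟨Y, subset_closure hY, klein_injOn hk Y.2 hmem hYeq⟩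
  have h1 := h.nonneg_of_exits p hexits
  have hNf : inner ℝ (N p).1 (klein f) = (N p).2 := by
    rw [lorentz] at hNF
    rw [klein, real_inner_smul_right, sub_eq_zero.1 hNF]
    field_simp
  rw [real_inner_smul_left, inner_sub_right, real_inner_smul_right, hNf,
    real_inner_self_eq_norm_sq] at h1
  rw [lorentz_self] at hN1
  have hσ1 : σ p = 1 := by
    refine (hσ p).resolve_right fun hneg => ?_
    rw [hneg] at h1
    nlinarith
  have h2 := h.support p (mem_image_of_mem (fun X : Hyp n k => klein (X : Mink n)) hX)
  simp only [hσ1, one_smul] at h2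
  rw [inner_klein_sub X.2.2.ne' hFp.ne' hNF] at h2
  by_contra hcon
  exact absurd h2 (not_lt.2 (div_nonneg (not_lt.1 hcon) X.2.2.le))

/-- If the region contains a ball of radius `R` around the base point, the time component of the
outward normal is at least `sinh (k R)`. -/
theorem sinh_le_of_lorentz_neg (hk : 0 < k) {M : Mink n} (hM : lorentz M M = 1) {R : ℝ}
    (hR : 0 < R) (h : ∀ X ∈ geodBall n k R, lorentz M (X : Mink n) < 0) :
    Real.sinh (k * R) ≤ M.2 := by
  rw [lorentz_self] at hM
  have hM1 : 0 < ‖M.1‖ := by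
    by_contra hcon
    have : ‖M.1‖ = 0 := le_antisymm (not_lt.1 hcon) (norm_nonneg _)
    rw [this] at hM
    nlinarith
  have key : ∀ ρ ∈ Ioo 0 R, Real.sinh (k * ρ) * ‖M.1‖ ≤ Real.cosh (k * ρ) * M.2 := by
    intro ρ hρ
    set X : Mink n := (1 / k) • (Real.sinh (k * ρ) • ‖M.1‖⁻¹ • M.1, Real.cosh (k * ρ)) with hX
    have hXX : X ∈ Hyp n k := by
      refine ⟨?_, ?_⟩
      · have hY : ‖Real.sinh (k * ρ) • ‖M.1‖⁻¹ • M.1‖ ^ 2 = Real.sinh (k * ρ) ^ 2 := by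
          rw [norm_smul, norm_smul, norm_inv, norm_norm, inv_mul_cancel₀ hM1.ne', mul_one,
            Real.norm_eq_abs, sq_abs]
        rw [hX, lorentz_smul_left, lorentz_smul_right, lorentz_self, hY, Real.cosh_sq]
        field_simp
        ring
      · simp only [hX, Prod.smul_mk, smul_eq_mul]
        have := Real.cosh_pos (k * ρ)
        positivity
    have hball : (⟨X, hXX⟩ : Hyp n k) ∈ geodBall n k R := by
      refine (radius_lt_iff hk hXX hR.le).2 ?_
      have e : k * X.2 = Real.cosh (k * ρ) := by
        simp only [hX, Prod.smul_mk, smul_eq_mul]; field_simp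
      rw [e, Real.cosh_lt_cosh, abs_of_pos (mul_pos hk hρ.1), abs_of_pos (mul_pos hk hR)]
      exact mul_lt_mul_of_pos_left hρ.2 hk
    have h1 : lorentz M X < 0 := h _ hball
    rw [hX, lorentz_smul_right, lorentz] at h1
    simp only [real_inner_smul_right, real_inner_self_eq_norm_sq] at h1
    have h2 := neg_of_mul_neg_right h1 (by positivity)
    have e : Real.sinh (k * ρ) * (‖M.1‖⁻¹ * ‖M.1‖ ^ 2) = Real.sinh (k * ρ) * ‖M.1‖ := by
      field_simp
    linarith
  have hlim : Real.sinh (k * R) * ‖M.1‖ ≤ Real.cosh (k * R) * M.2 := by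
    have h1 : Continuous fun ρ => Real.sinh (k * ρ) * ‖M.1‖ := by fun_prop
    have h2 : Continuous fun ρ => Real.cosh (k * ρ) * M.2 := by fun_prop
    refine le_of_tendsto_of_tendsto (b := 𝓝[<] R) (h1.continuousAt.tendsto.mono_left
      nhdsWithin_le_nhds) (h2.continuousAt.tendsto.mono_left nhdsWithin_le_nhds) ?_
    filter_upwards [Ioo_mem_nhdsLT hR] with ρ hρ using key ρ hρ
  have hs : 0 < Real.sinh (k * R) := Real.sinh_pos_iff.2 (mul_pos hk hR)
  have hc := Real.cosh_pos (k * R)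
  have hM2 : 0 < M.2 := pos_of_mul_pos_right ((mul_pos hs hM1).trans_le hlim) hc.le
  have hsq := pow_le_pow_left₀ (mul_pos hs hM1).le hlim 2
  rw [mul_pow, mul_pow, Real.cosh_sq] at hsq
  refine (sq_le_sq₀ hs.le hM2.le).1 ?_
  nlinarith

end Region

end HypFoliation

end

theorem lemma4p2 {n : ℕ} (hn : 3 ≤ n) {k : ℝ} (hk : 0 < k)
    {S : Type*} [TopologicalSpace S] [ChartedSpace (EuclideanSpace ℝ (Fin (n - 1))) S]
    [IsManifold (𝓡 (n - 1)) ∞ S]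
    (hsphere : Nonempty (S ≃ₜ Metric.sphere (0 : EuclideanSpace ℝ (Fin n)) 1))
    (F : S → HypFoliation.Hyp n k) (hF : HypFoliation.IsSmoothEmb F)
    (hK : HypFoliation.SectionalCurvatureGT F (-k ^ 2))
    (Ω₀ : Set (HypFoliation.Hyp n k)) (hΩ₀ : HypFoliation.Encloses F Ω₀)
    (N : S → HypFoliation.Mink n) (hN : HypFoliation.IsOutwardUnitNormal F Ω₀ N)
    (R₁ R₂ : ℝ) (hR₁ : 0 < R₁)
    (hball₁ : HypFoliation.geodBall n k R₁ ⊆ Ω₀) (hball₂ : Ω₀ ⊆ HypFoliation.geodBall n k R₂)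
    (y : EuclideanSpace ℝ (Fin n)) (hy : ∑ i, y i ^ 2 = 1)
    (r φ : S → ℝ → ℝ)
    (hr : ∀ p ρ, r p ρ = HypFoliation.radius k (HypFoliation.flow F N p ρ))
    (hφ : ∀ p ρ, φ p ρ = ∑ i, HypFoliation.angular (HypFoliation.flow F N p ρ) i * y i)
    (p : S) (ρ : ℝ) (hρ : 0 < ρ) :
    0 < r p ρ ∧ DifferentiableAt ℝ (r p) ρ ∧ DifferentiableAt ℝ (φ p) ρ ∧
    (deriv (φ p) ρ) ^ 2 ≤
      (1 - φ p ρ ^ 2) * k ^ 2 * Real.sinh (k * r p ρ) ^ (-2 : ℤ) * (1 - (deriv (r p) ρ) ^ 2) ∧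
    Real.sinh (k * R₁) / Real.sinh (k * R₂) ≤ deriv (r p) ρ ∧
    |deriv (φ p) ρ| ≤
      (1 / Real.sinh (k * R₁) *
        (Real.sinh (k * R₂) ^ 2 / Real.sinh (k * R₁) ^ 2 - 1) ^ (1 / 2 : ℝ)) *
        k * deriv (r p) ρ := by
  open HypFoliation in
  obtain ⟨e⟩ := hsphere
  have hfin : Module.finrank ℝ (EuclideanSpace ℝ (Fin n)) = n := by simp
  have : Nontrivial (EuclideanSpace ℝ (Fin n)) :=
    Module.nontrivial_of_finrank_pos (R := ℝ) (by omega)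
  have hrank : 1 < Module.rank ℝ (EuclideanSpace ℝ (Fin n)) := by
    rw [← Module.finrank_eq_rank, hfin]
    exact_mod_cast (by omega : 1 < n)
  have : ConnectedSpace (Metric.sphere (0 : EuclideanSpace ℝ (Fin n)) 1) :=
    isConnected_iff_connectedSpace.1 (isConnected_sphere hrank 0 zero_le_one)
  have : Nontrivial (Metric.sphere (0 : EuclideanSpace ℝ (Fin n)) 1) := by
    obtain ⟨v, hv⟩ := NormedSpace.sphere_nonempty (E := EuclideanSpace ℝ (Fin n)) (x := 0)
      (r := 1) |>.2 zero_le_one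
    rw [mem_sphere_zero_iff_norm] at hv
    refine ⟨⟨v, by simpa using hv⟩, ⟨-v, by simpa using hv⟩, fun h => ?_⟩
    have h1 : v = -v := congrArg Subtype.val h
    have h0 : v = 0 := by
      have h2 : (2 : ℝ) • v = 0 := by rw [two_smul, ← sub_neg_eq_add, ← h1, sub_self]
      exact (smul_eq_zero.1 h2).resolve_left two_ne_zero
    rw [h0, norm_zero] at hv
    exact zero_ne_one hv
  have : CompactSpace S := e.symm.compactSpace
  have : T2Space S := e.symm.t2Space
  have : ConnectedSpace S := e.symm.surjective.connectedSpace e.symm.continuous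
  have : Nontrivial S := e.toEquiv.nontrivial
  have hneg : ∀ X ∈ geodBall n k R₁, lorentz (N p) (X : Mink n) < 0 := fun X hX =>
    lorentz_normal_neg hn hk hF hK hΩ₀ hN p (hball₁ hX)
  have hN2 := sinh_le_of_lorentz_neg hk (hN p).1 hR₁ hneg
  have hR₂ : 0 < R₂ := by
    have ho : ((0, 1 / k) : Mink n) ∈ Hyp n k := by
      refine ⟨?_, by positivity⟩
      rw [lorentz_self]
      simp
    have hoB : (⟨_, ho⟩ : Hyp n k) ∈ geodBall n k R₁ := by
      refine (radius_lt_iff hk ho hR₁.le).2 ?_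
      rw [mul_one_div_cancel hk.ne']
      exact Real.one_lt_cosh.2 (by positivity)
    exact (radius_nonneg hk ho).trans_lt (hball₂ (hball₁ hoB))
  have hfr : F p ∈ frontier Ω₀ := by rw [hΩ₀.2.2.2]; exact mem_range_self p
  have hF₂ := closure_subset_of_subset_geodBall hk hR₂.le hball₂ (frontier_subset_closure hfr)
  have hF₁ : Real.cosh (k * R₁) ≤ k * (F p : Mink n).2 := by
    rw [hΩ₀.1.frontier_eq] at hfr
    by_contra hcon
    exact hfr.2 (hball₁ ((radius_lt_iff hk (F p).2 hR₁.le).2 (not_le.1 hcon)))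
  have hy1 : ‖y‖ = 1 := by
    rw [EuclideanSpace.norm_eq, Real.sqrt_eq_one]
    simpa using hy
  exact polar_estimates hk (F p).2 (hN p).1 (hN p).2.1 hR₁ hR₂ hN2 hF₁ hF₂ hy1
    (funext (hr p)) (funext (hφ p)) hρ
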